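/- Let $a>0$, $\mathbf v_1=a(\tfrac{\sqrt3}2,\tfrac12)$, $\mathbf v_2=a(\tfrac{\sqrt3}2,-\tfrac12)$, $\Lambda=\mathbb Z\mathbf v_1\oplus\mathbb Z\mathbf v_2$, $\Gamma=\mathbb R^2/\Lambda$, $\mathbf x_0=\tfrac23(\mathbf v_1+\mathbf v_2)$, and let $\mathbf y_1=\mathbf 0$, $\mathbf y_2=\mathbf x_0$ be the two points of the honeycomb lattice $\Lambda\cup(\Lambda+\mathbf x_0)$ in a fundamental cell. Let $\mathbf k_1,\mathbf k_2$ be the dual basis, $\mathbf k_i\cdot\mathbf v_j=2\pi\delta_{ij}$, put $\xi_{\mathbf m}=m_1\mathbf k_1+m_2\mathbf k_2$ for $\mathbf m\in\mathbb Z^2$, and let $\mathcal B=\{\mathbf k\in\mathbb R^2: |\mathbf k|\le|\mathbf k-\xi_{\mathbf m}|\ \text{for all }\mathbf m\in\mathbb Z^2\}$ be the hexagonal Brillouin zone. For real $\lambda\notin\{|\xi_{\mathbf m}+\mathbf k|^2:\mathbf m\in\mathbb Z^2\}$ let $$g_\lambda(\mathbf x,\mathbf k)=\frac1{\mathrm{area}(\Gamma)}\lim_{r\to\infty}\sum_{|\xi_{\mathbf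 m}+\mathbf k|\le r}\frac{e^{i(\xi_{\mathbf m}+\mathbf k)\cdot\mathbf x}}{|\xi_{\mathbf m}+\mathbf k|^2-\lambda}\quad(\mathbf x\notin\Lambda),$$ $$g_\lambda(\mathbf x,\mathbf k)=\frac1{\mathrm{area}(\Gamma)}\lim_{r\to\infty}\Big[\sum_{|\xi_{\mathbf m}+\mathbf k|\le r}\frac1{|\xi_{\mathbf m}+\mathbf k|^2-\lambda}-\frac{2\pi}{\mathrm{area}(\mathcal B)}\ln r\Big]\quad(\mathbf x\in\Lambda).$$ For $\alpha\in(-\infty,\infty]$ and $\mathbf k\in\mathbb R^2$ let $-\Delta_\alpha(\mathbf k)$ be the Floquet fiber at quasi-momentum $\mathbf k$ of the honeycomb point scatterer with equal parameters $\alpha$ at $\mathbf y_1$ and $\mathbf y_2$. In Fourier coefficients with respect to $e^{i(\xi_{\mathbf m}+\mathbf k)\cdot\mathbf x}$ it is the self-adjoint operator on $\ell^2(\mathbb Z^2)$ with resolvent $$\big((-\Delta_\alpha(\mathbf k)-\lambda)^{-1}f\big)_{\mathbf m}=\frac{f_{\mathbf m}}{|\xi_{\mathbf m}+\mathbf k|^2-\lambda}+\frac1{\mathrm{area}(\Gamma)}\sum_{j,j'=1}^2[\Gamma_\alpha(\lambda,\mathbf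 k)^{-1}]_{jj'}\,(F_{\lambda,j},f)\,F_{\lambda,j'}(\mathbf m),$$ for all real $\lambda\notin\{|\xi_{\mathbf m}+\mathbf k|^2\}$ for which $\Gamma_\alpha(\lambda,\mathbf k)$ is invertible, where $(\cdot,\cdot)$ is the inner product of $\ell^2(\mathbb Z^2)$, conjugate-linear in the first argument, $F_{\lambda,j}(\mathbf m)=\dfrac{e^{-i(\xi_{\mathbf m}+\mathbf k)\cdot\mathbf y_j}}{|\xi_{\mathbf m}+\mathbf k|^2-\lambda}$ and $[\Gamma_\alpha(\lambda,\mathbf k)]_{jj'}=\alpha\delta_{jj'}-g_\lambda(\mathbf y_{j'}-\mathbf y_j,\mathbf k)$; for $\alpha=\infty$ the second term is absent and no invertibility is required, so that $-\Delta_\infty(\mathbf k)$ is the free Floquet Laplacian. Let $\lambda_1(\mathbf k,\alpha)$ denote its lowest eigenvalue. Then for every $\alpha\in(-\infty,\infty]$ the operator $-\Delta_\alpha(\mathbf k)$ has a lowest eigenvalue for every $\mathbf k\in\mathcal B$, and the first band attains its minimum over the Brillouin zone at $\mathbf k=\mathbf 0$: $$\min_{\mathbf k\in\mathcal B}\lambda_1(\mathbf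 k,\alpha)=\lambda_1(\mathbf 0,\alpha).$$ -/

import Mathlib

open Filter Topology
open scoped ComplexConjugate

noncomputable section

namespace Honeycomb

/-- The plane `ℝ²` with its Euclidean norm. -/
abbrev Plane : Type := EuclideanSpace ℝ (Fin 2)

/-- First generator of the triangular lattice with lattice constant `a`. -/
def v₁ (a : ℝ) : Plane := !₂[a * (√3 / 2), a * (1 / 2)]

/-- Second generator of the triangular lattice. -/
def v₂ (a : ℝ) : Plane := !₂[a * (√3 / 2), -(a * (1 / 2))]

/-- The triangular lattice `Λ = ℤ v₁ ⊕ ℤ v₂`. -/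
def triangularLattice (a : ℝ) : Set Plane :=
  Set.range fun m : ℤ × ℤ => (m.1 : ℝ) • v₁ a + (m.2 : ℝ) • v₂ a

/-- The displacement `x₀ = (2/3)(v₁ + v₂)` of the second sublattice of the honeycomb lattice
`H = Λ ∪ (Λ + x₀)`. -/
def x₀ (a : ℝ) : Plane := (2 / 3 : ℝ) • (v₁ a + v₂ a)

/-- The two scatterers `y₁ = 0`, `y₂ = x₀` of the fundamental cell. -/
def scatterer (a : ℝ) : Fin 2 → Plane := ![0, x₀ a]

/-- First generator of the dual lattice, `k_i · v_j = 2π δ_ij`. -/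
def k₁ (a : ℝ) : Plane :=
  !₂[4 * Real.pi / (a * √3) * (1 / 2), 4 * Real.pi / (a * √3) * (√3 / 2)]

/-- Second generator of the dual lattice. -/
def k₂ (a : ℝ) : Plane :=
  !₂[4 * Real.pi / (a * √3) * (1 / 2), -(4 * Real.pi / (a * √3) * (√3 / 2))]

/-- The dual lattice vector `ξ_m = m₁ k₁ + m₂ k₂`. -/
def ξ (a : ℝ) (m : ℤ × ℤ) : Plane := (m.1 : ℝ) • k₁ a + (m.2 : ℝ) • k₂ a

/-- Area of the parallelogram spanned by two vectors of the plane. -/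
def parallelogramArea (u w : Plane) : ℝ := |u 0 * w 1 - u 1 * w 0|

/-- The area of the fundamental domain `Γ = ℝ² / Λ`. -/
def areaΓ (a : ℝ) : ℝ := parallelogramArea (v₁ a) (v₂ a)

/-- The area of the Brillouin zone, a fundamental domain of the dual lattice. -/
def areaB (a : ℝ) : ℝ := parallelogramArea (k₁ a) (k₂ a)

/-- The (closed, hexagonal) Brillouin zone: the points of the plane which are at least as close
to the origin as to any other point of the dual lattice. -/
def brillouinZone (a : ℝ) : Set Plane := {k | ∀ m : ℤ × ℤ, ‖k‖ ≤ ‖k - ξ a m‖}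

/-- The eigenvalue `|ξ_m + k|²` of the free Floquet Laplacian `-Δ(k)`. -/
def freeEigenvalue (a : ℝ) (k : Plane) (m : ℤ × ℤ) : ℝ := ‖ξ a m + k‖ ^ 2

/-- The plane wave `e^{i (ξ_m + k) · x}`. -/
def wave (a : ℝ) (k : Plane) (m : ℤ × ℤ) (x : Plane) : ℂ :=
  Complex.exp (Complex.I * ((inner ℝ (ξ a m + k) x : ℝ) : ℂ))

open Classical in
/-- Sum of `f m` over the finitely many `m` with `|ξ_m + k| ≤ r`. -/
def cutoffSum (a : ℝ) (k : Plane) (f : ℤ × ℤ → ℂ) (r : ℝ) : ℂ :=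
  ∑' m : ℤ × ℤ, if ‖ξ a m + k‖ ≤ r then f m else 0

open Classical in
/-- The function `g_λ(x, k)`. Off the lattice it is the (conditionally convergent) series
`area(Γ)⁻¹ ∑ e^{i(ξ_m + k)·x} / (|ξ_m + k|² - λ)`, summed over growing discs `|ξ_m + k| ≤ r`;
on the lattice it is the limit renormalized by `(2π / area(B)) ln r`. -/
def g (a : ℝ) (l : ℝ) (x k : Plane) : ℂ :=
  if x ∈ triangularLattice a then
    (areaΓ a : ℂ)⁻¹ * limUnder atTop fun r : ℝ =>
      cutoffSum a k (fun m => 1 / ((freeEigenvalue a k m : ℂ) - (l : ℂ))) r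
        - ((2 * Real.pi / areaB a * Real.log r : ℝ) : ℂ)
  else
    (areaΓ a : ℂ)⁻¹ * limUnder atTop fun r : ℝ =>
      cutoffSum a k (fun m => wave a k m x / ((freeEigenvalue a k m : ℂ) - (l : ℂ))) r

/-- The matrix `[Γ_α(λ, k)]_{jj'} = α δ_{jj'} - g_λ(y_{j'} - y_j, k)`, for finite `α`. -/
def gammaMatrix (a : ℝ) (α : ℝ) (l : ℝ) (k : Plane) : Matrix (Fin 2) (Fin 2) ℂ :=
  Matrix.of fun j j' =>
    (if j = j' then (α : ℂ) else 0) - g a l (scatterer a j' - scatterer a j) k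

/-- The function `F_{λ,y_j}(k, ξ_m) = e^{-i(ξ_m + k)·y_j} / (|ξ_m + k|² - λ)`. -/
def F (a : ℝ) (l : ℝ) (k : Plane) (j : Fin 2) (m : ℤ × ℤ) : ℂ :=
  wave a k m (-scatterer a j) / ((freeEigenvalue a k m : ℂ) - (l : ℂ))

/-- The Hilbert space `ℓ²(Λ*)` of Fourier coefficients of functions in `L²_k`, the coefficient of
`e^{i(ξ_m + k)·x}` being indexed by `m ∈ ℤ²`. -/
abbrev FiberSpace : Type := lp (fun _ : ℤ × ℤ => ℂ) 2

/-- `l` is a real point at which the resolvent formula is available: it is no free eigenvalue and,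
for finite `α`, the matrix `Γ_α(l, k)` is invertible. -/
def IsRegularPoint (a : ℝ) (α : WithTop ℝ) (k : Plane) (l : ℝ) : Prop :=
  l ∉ Set.range (freeEigenvalue a k) ∧ ∀ b : ℝ, α = (b : WithTop ℝ) →
    IsUnit (gammaMatrix a b l k).det

/-- The inverse matrix `Γ_α(λ, k)⁻¹`, which is `0` for `α = ∞` (no scatterers). -/
def gammaInv (a : ℝ) (α : WithTop ℝ) (l : ℝ) (k : Plane) : Matrix (Fin 2) (Fin 2) ℂ :=
  match α with
  | ⊤ => 0
  | (b : ℝ) => (gammaMatrix a b l k)⁻¹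

/-- The Fourier coefficients of `(-Δ_α(k) - λ)⁻¹ f`, given by
`G_λ(k) f + area(Γ)⁻¹ ∑_{j,j'} [Γ_α(λ,k)⁻¹]_{jj'} (F_{λ,y_j}, f) F_{λ,y_{j'}}`,
where `G_λ(k)` is multiplication by `(|ξ_m + k|² - λ)⁻¹`. -/
def resolventApply (a : ℝ) (α : WithTop ℝ) (k : Plane) (l : ℝ) (f : FiberSpace)
    (m : ℤ × ℤ) : ℂ :=
  f m / ((freeEigenvalue a k m : ℂ) - (l : ℂ)) +
    (areaΓ a : ℂ)⁻¹ * ∑ j : Fin 2, ∑ j' : Fin 2,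
      gammaInv a α l k j j' * (∑' n : ℤ × ℤ, conj (F a l k j n) * f n) * F a l k j' m

/-- The graph of the fiber operator `-Δ_α(k)` of the honeycomb point scatterer with equal
parameters `α` at `0` and `x₀`: the operator whose resolvent is given by `resolventApply`. So
`ψ` is in the domain and `-Δ_α(k) ψ = h` iff `ψ = (-Δ_α(k) - λ)⁻¹ (h - λ ψ)`. -/
def operatorGraph (a : ℝ) (α : WithTop ℝ) (k : Plane) : Set (FiberSpace × FiberSpace) :=
  {p | ∀ l : ℝ, IsRegularPoint a α k l →
    ∀ m : ℤ × ℤ, p.1 m = resolventApply a α k l (p.2 - (l : ℂ) • p.1) m}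

/-- The set of eigenvalues of the (self-adjoint) operator `-Δ_α(k)`. -/
def eigenvalues (a : ℝ) (α : WithTop ℝ) (k : Plane) : Set ℝ :=
  {μ | ∃ ψ : FiberSpace, ψ ≠ 0 ∧ (ψ, (μ : ℂ) • ψ) ∈ operatorGraph a α k}

/-- The first band function `λ₁(k, α)`: the lowest eigenvalue of `-Δ_α(k)`. -/
def lowestBand (a : ℝ) (α : WithTop ℝ) (k : Plane) : ℝ := sInf (eigenvalues a α k)

end Honeycomb

end

noncomputable section

namespace Honeycomb

open MeasureTheory Module

/-! For `α = ∞` the lowest eigenvalue on the Brillouin zone is `‖k‖ ^ 2`, and nothing remains to be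
shown. For finite `α`, `Γ_α(l, k)` is Hermitian with equal diagonal entries, so its eigenvalues are
`α - g₀ ± |g_l(x₀, k)|`. Away from the free spectrum, `l` is an eigenvalue of the fiber exactly
where `Γ_α(l, k)` is singular. The lowest eigenvalue is therefore the first `l < ‖k‖ ^ 2` at which
`topEigenvalue a k l = g₀ + |g_l(x₀, k)|` reaches `α`. Such an `l` exists because this function is
continuous and nondecreasing below `‖k‖ ^ 2`, tends to `-∞` as `l → -∞`, and is unbounded above near
`‖k‖ ^ 2` (`exists_first_crossing`, `isLeast_eigenvalues`).

The decisive inequality is `topEigenvalue_le_zero_momentum`: for `l < 0` the top eigenvalue is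
largest at `k = 0`. If the lowest eigenvalue at `k` were below the one at `0`, it would be negative,
since the latter lies below `‖0‖ ^ 2 = 0`; the top eigenvalue at `0` would then already be at least
`α` before its first crossing.

The inequality is a diamagnetic one. Differences `g_l - g_l'` are absolutely convergent sums, equal
up to the factor `(areaΓ a)⁻¹` to integrals of the torus heat kernel against the positive weight
`e^{lt} - e^{l't}`. By Poisson summation the heat kernel at `k` is a sum of Gaussians with phases,
which is largest in modulus at `k = 0` (`norm_tsum_heatTerm_le`). It remains to send `l' → -∞`. The
values `g_l'(0, k)` diverge logarithmically, but with the same leading term for all `k` and an error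
tending to zero, while `g_l'(x₀, k) → 0`. Both facts come from comparing lattice sums with integrals
over cells; at `x₀` the phases of three residue classes cancel the logarithms. -/

/-! ### Cells and summability for planar lattices -/

/-- The point with integer coordinates `n` in the basis `b`, translated by `p`. -/
def latticePoint (b : Basis (Fin 2) ℝ Plane) (p : Plane) (n : ℤ × ℤ) : Plane :=
  (n.1 : ℝ) • b 0 + (n.2 : ℝ) • b 1 + p

/-- The translate of the fundamental parallelogram of `b` attached to `latticePoint b p n`. -/
def latticeCell (b : Basis (Fin 2) ℝ Plane) (p : Plane) (n : ℤ × ℤ) : Set Plane :=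
  (fun x => x - latticePoint b p n) ⁻¹' ZSpan.fundamentalDomain b

/-- The area of the fundamental parallelogram of `b`. -/
def cellArea (b : Basis (Fin 2) ℝ Plane) : ℝ := parallelogramArea (b 0) (b 1)

theorem cellArea_eq_abs_det (b : Basis (Fin 2) ℝ Plane) :
    cellArea b = |(EuclideanSpace.basisFun (Fin 2) ℝ).toBasis.det b| := by
  rw [cellArea, parallelogramArea, Basis.det_apply, Matrix.det_fin_two]
  simp only [Basis.toMatrix_apply, OrthonormalBasis.coe_toBasis_repr_apply,
    EuclideanSpace.basisFun_repr]
  congr 1; ring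

theorem cellArea_pos (b : Basis (Fin 2) ℝ Plane) : 0 < cellArea b := by
  rw [cellArea_eq_abs_det, abs_pos]
  exact (Basis.isUnit_det _ b).ne_zero

theorem volume_real_fundamentalDomain (b : Basis (Fin 2) ℝ Plane) :
    volume.real (ZSpan.fundamentalDomain b) = cellArea b := by
  rw [ZSpan.measureReal_fundamentalDomain b volume (EuclideanSpace.basisFun (Fin 2) ℝ).toBasis,
    measureReal_congr (ZSpan.fundamentalDomain_ae_parallelepiped _ volume), ← cellArea_eq_abs_det,
    measureReal_def, OrthonormalBasis.coe_toBasis, OrthonormalBasis.volume_parallelepiped]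
  simp

theorem measurableSet_latticeCell (b : Basis (Fin 2) ℝ Plane) (p : Plane) (n : ℤ × ℤ) :
    MeasurableSet (latticeCell b p n) :=
  (ZSpan.fundamentalDomain_measurableSet b).preimage (by fun_prop)

theorem volume_real_latticeCell (b : Basis (Fin 2) ℝ Plane) (p : Plane) (n : ℤ × ℤ) :
    volume.real (latticeCell b p n) = cellArea b := by
  rw [← volume_real_fundamentalDomain b, measureReal_def, measureReal_def, latticeCell]
  simp only [sub_eq_add_neg, measure_preimage_add_right]

theorem norm_sub_latticePoint_le {b : Basis (Fin 2) ℝ Plane} {p : Plane} {n : ℤ × ℤ} {x : Plane}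
    (hx : x ∈ latticeCell b p n) : ‖x - latticePoint b p n‖ ≤ ‖b 0‖ + ‖b 1‖ := by
  have h := ZSpan.norm_fract_le b (x - latticePoint b p n)
  rwa [ZSpan.fract_eq_self.2 hx, Fin.sum_univ_two] at h

theorem repr_sub_latticePoint (b : Basis (Fin 2) ℝ Plane) (p x : Plane) (n : ℤ × ℤ) :
    b.repr (x - latticePoint b p n) 0 = b.repr (x - p) 0 - n.1 ∧
    b.repr (x - latticePoint b p n) 1 = b.repr (x - p) 1 - n.2 := by
  constructor <;> simp [latticePoint] <;> ring

theorem mem_latticeCell_iff {b : Basis (Fin 2) ℝ Plane} {p x : Plane} {n : ℤ × ℤ} :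
    x ∈ latticeCell b p n ↔ n = (⌊b.repr (x - p) 0⌋, ⌊b.repr (x - p) 1⌋) := by
  rw [latticeCell, Set.mem_preimage, ZSpan.mem_fundamentalDomain, Fin.forall_fin_two,
    (repr_sub_latticePoint b p x n).1, (repr_sub_latticePoint b p x n).2, Prod.ext_iff,
    eq_comm (a := n.1), eq_comm (a := n.2), Int.floor_eq_iff, Int.floor_eq_iff]
  simp only [Set.mem_Ico, sub_nonneg, sub_lt_iff_lt_add']

theorem pairwise_disjoint_latticeCell (b : Basis (Fin 2) ℝ Plane) (p : Plane) :
    Pairwise (Function.onFun Disjoint (latticeCell b p)) := by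
  intro m n hmn
  rw [Function.onFun, Set.disjoint_left]
  intro x hm hn
  exact hmn ((mem_latticeCell_iff.1 hm).trans (mem_latticeCell_iff.1 hn).symm)

/-- The exponent 3 exceeds the rank 2 of the lattice. Adding 1 to the norm keeps the bound
meaningful when the translated lattice passes through the origin. -/
theorem summable_latticePoint (b : Basis (Fin 2) ℝ Plane) (p : Plane) :
    Summable fun n => ((1 + ‖latticePoint b p n‖)⁻¹) ^ 3 := by
  have hr : finrank ℤ (Submodule.span ℤ (Set.range b)) = 2 := by
    rw [ZLattice.rank ℝ]; simp
  have h := ZLattice.summable_norm_sub_inv_pow (Submodule.span ℤ (Set.range b)) 3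
    (by rw [hr]; norm_num) (-p)
  let e : ℤ × ℤ → Submodule.span ℤ (Set.range b) := fun n =>
    ⟨n.1 • b 0 + n.2 • b 1, add_mem (Submodule.smul_mem _ _ (Submodule.subset_span ⟨0, rfl⟩))
      (Submodule.smul_mem _ _ (Submodule.subset_span ⟨1, rfl⟩))⟩
  have he : ∀ n, ((e n : Plane) - -p) = latticePoint b p n := by
    intro n
    simp [e, latticePoint, ← Int.cast_smul_eq_zsmul ℝ]
  have hinj : Function.Injective (latticePoint b p) := by
    intro m n hmn
    have h1 := repr_sub_latticePoint b p (latticePoint b p m) m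
    have h2 := repr_sub_latticePoint b p (latticePoint b p m) n
    rw [← hmn, h1.1, h1.2] at h2
    ext
    · exact_mod_cast (sub_right_inj.1 h2.1)
    · exact_mod_cast (sub_right_inj.1 h2.2)
  have hei : Function.Injective e := by
    intro m n hmn
    apply hinj
    rw [← he, ← he, hmn]
  have h' := h.comp_injective hei
  refine Summable.of_norm_bounded_eventually h' ?_
  -- At a lattice point equal to `0` the comparison term is the default value `0⁻¹ = 0`; this
  -- affects at most one index.
  refine ((Set.finite_singleton (0 : Plane)).preimage hinj.injOn).subset ?_
  intro n hn
  by_contra hne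
  apply hn
  have hpos : 0 < ‖latticePoint b p n‖ := norm_pos_iff.2 hne
  simp only [Function.comp, he]
  change ‖(1 + ‖latticePoint b p n‖)⁻¹ ^ 3‖ ≤ ‖latticePoint b p n‖⁻¹ ^ 3
  rw [Real.norm_of_nonneg (by positivity)]
  gcongr
  linarith

theorem finite_latticePoint_norm_le (b : Basis (Fin 2) ℝ Plane) (p : Plane) (r : ℝ) :
    {n | ‖latticePoint b p n‖ ≤ r}.Finite := by
  by_cases hr : 0 ≤ r
  · have h := (summable_latticePoint b p).tendsto_cofinite_zero
    have h2 := h.eventually (gt_mem_nhds (show (0 : ℝ) < ((1 + r)⁻¹) ^ 3 by positivity))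
    refine Set.Finite.subset h2 ?_
    intro n hn hlt
    change ‖latticePoint b p n‖ ≤ r at hn
    change (1 + ‖latticePoint b p n‖)⁻¹ ^ 3 < (1 + r)⁻¹ ^ 3 at hlt
    refine absurd hlt (not_lt.2 ?_)
    gcongr
  · convert Set.finite_empty
    ext n
    simp only [Set.mem_ofPred_eq, Set.mem_empty_iff_false, iff_false]
    intro h
    exact hr ((norm_nonneg _).trans h)

/-! ### Lattice sums against integrals over cells -/

theorem continuous_inv_norm_sq_add {c : ℝ} (hc : 0 < c) :
    Continuous fun x : Plane => (‖x‖ ^ 2 + c)⁻¹ := by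
  refine Continuous.inv₀ (by fun_prop) fun x => ?_
  positivity

theorem integral_closedBall_inv_norm_sq_add {c : ℝ} (hc : 0 < c) {R : ℝ} (hR : 0 ≤ R) :
    ∫ x in Metric.closedBall (0 : Plane) R, (‖x‖ ^ 2 + c)⁻¹ =
      Real.pi * (Real.log (R ^ 2 + c) - Real.log c) := by
  have h1 : ∫ x in Metric.closedBall (0 : Plane) R, (‖x‖ ^ 2 + c)⁻¹ =
      ∫ x : Plane, (Set.Iic R).indicator (fun y : ℝ => (y ^ 2 + c)⁻¹) ‖x‖ := by
    rw [← integral_indicator measurableSet_closedBall]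
    congr 1
    ext x
    by_cases h : ‖x‖ ≤ R
    · rw [Set.indicator_of_mem (mem_closedBall_zero_iff.2 h), Set.indicator_of_mem (Set.mem_Iic.2 h)]
    · rw [Set.indicator_of_notMem (mt mem_closedBall_zero_iff.1 h),
        Set.indicator_of_notMem (mt Set.mem_Iic.1 h)]
  have hpi : volume.real (Metric.ball (0 : Plane) 1) = Real.pi := by
    rw [measureReal_def, EuclideanSpace.volume_ball_fin_two]
    simp [Real.pi_pos.le]
  have h2 : ∫ y in Set.Ioi (0 : ℝ), y ^ (finrank ℝ Plane - 1) •
      (Set.Iic R).indicator (fun y : ℝ => (y ^ 2 + c)⁻¹) y =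
      ∫ y in (0 : ℝ)..R, y * (y ^ 2 + c)⁻¹ := by
    rw [intervalIntegral.integral_of_le hR, ← Set.Ioi_inter_Iic, Set.inter_comm,
      ← Measure.restrict_restrict measurableSet_Iic, ← integral_indicator measurableSet_Iic]
    congr 1
    ext y
    simp [Set.indicator_apply]
  have h3 : ∫ y in (0 : ℝ)..R, y * (y ^ 2 + c)⁻¹ =
      Real.log (R ^ 2 + c) / 2 - Real.log ((0 : ℝ) ^ 2 + c) / 2 := by
    refine intervalIntegral.integral_eq_sub_of_hasDerivAt (f := fun y => Real.log (y ^ 2 + c) / 2)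
      (fun y _ => ?_) ?_
    · have hp : y ^ 2 + c ≠ 0 := by positivity
      have := (((hasDerivAt_pow 2 y).add_const c).log hp).div_const 2
      refine this.congr_deriv ?_
      push_cast
      field_simp
    · refine Continuous.intervalIntegrable ?_ _ _
      refine continuous_id.mul (Continuous.inv₀ (by fun_prop) fun y => ?_)
      positivity
  rw [h1, integral_fun_norm_addHaar, h2, h3, hpi]
  simp
  ring

/-- The defect between `(‖x‖² + c)⁻¹` at a lattice point and its mean over the attached cell. -/
def cellDefect (b : Basis (Fin 2) ℝ Plane) (p : Plane) (c : ℝ) (n : ℤ × ℤ) : ℝ :=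
  (‖latticePoint b p n‖ ^ 2 + c)⁻¹ -
    (cellArea b)⁻¹ * ∫ x in latticeCell b p n, (‖x‖ ^ 2 + c)⁻¹

theorem latticeCell_subset_closedBall (b : Basis (Fin 2) ℝ Plane) (p : Plane) (n : ℤ × ℤ) :
    latticeCell b p n ⊆ Metric.closedBall (latticePoint b p n) (‖b 0‖ + ‖b 1‖) := by
  intro x hx
  rw [mem_closedBall_iff_norm]
  exact norm_sub_latticePoint_le hx

theorem volume_latticeCell_lt_top (b : Basis (Fin 2) ℝ Plane) (p : Plane) (n : ℤ × ℤ) :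
    volume (latticeCell b p n) < ⊤ :=
  (measure_mono (latticeCell_subset_closedBall b p n)).trans_lt measure_closedBall_lt_top

theorem integrableOn_latticeCell (b : Basis (Fin 2) ℝ Plane) (p : Plane) (n : ℤ × ℤ) {c : ℝ}
    (hc : 0 < c) : IntegrableOn (fun x : Plane => (‖x‖ ^ 2 + c)⁻¹) (latticeCell b p n) :=
  ((continuous_inv_norm_sq_add hc).continuousOn.integrableOn_compact
    (isCompact_closedBall _ _)).mono_set (latticeCell_subset_closedBall b p n)

theorem abs_cellDefect_le {b : Basis (Fin 2) ℝ Plane} {p : Plane} {c : ℝ} (hc : 0 < c)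
    {n : ℤ × ℤ} {M : ℝ}
    (hM : ∀ x ∈ latticeCell b p n,
      |(‖latticePoint b p n‖ ^ 2 + c)⁻¹ - (‖x‖ ^ 2 + c)⁻¹| ≤ M) :
    |cellDefect b p c n| ≤ M := by
  have hA := cellArea_pos b
  have h : cellDefect b p c n = (cellArea b)⁻¹ * ∫ x in latticeCell b p n,
      ((‖latticePoint b p n‖ ^ 2 + c)⁻¹ - (‖x‖ ^ 2 + c)⁻¹) := by
    have hi : IntegrableOn (fun _ : Plane => (‖latticePoint b p n‖ ^ 2 + c)⁻¹)
        (latticeCell b p n) := integrableOn_const (volume_latticeCell_lt_top b p n).ne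
    rw [integral_sub hi
      (integrableOn_latticeCell b p n hc), setIntegral_const, volume_real_latticeCell, cellDefect,
      smul_eq_mul, mul_sub, inv_mul_cancel_left₀ hA.ne']
  have h2 := norm_setIntegral_le_of_norm_le_const (volume_latticeCell_lt_top b p n)
    (f := fun x => (‖latticePoint b p n‖ ^ 2 + c)⁻¹ - (‖x‖ ^ 2 + c)⁻¹) (C := M) hM
  rw [volume_real_latticeCell, Real.norm_eq_abs] at h2
  rw [h, abs_mul, abs_of_pos (inv_pos.2 hA), inv_mul_le_iff₀ hA, mul_comm]
  exact h2

/-- The gradient of `(‖x‖ ^ 2 + c)⁻¹` decays cubically, which is summable over a planar lattice. The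
bound does not involve `c`, as dominated convergence for `c → ∞` requires. -/
theorem abs_inv_norm_sq_sub_le {c d : ℝ} (hc : 1 ≤ c) {x y : Plane} (h : ‖x - y‖ ≤ d) :
    |(‖y‖ ^ 2 + c)⁻¹ - (‖x‖ ^ 2 + c)⁻¹| ≤ 16 * d * (1 + d) ^ 3 * ((1 + ‖y‖)⁻¹) ^ 3 := by
  have hd : 0 ≤ d := (norm_nonneg _).trans h
  have h1 : |‖x‖ - ‖y‖| ≤ d := (abs_norm_sub_norm_le x y).trans h
  have hx := norm_nonneg x
  have hy := norm_nonneg y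
  have hle : ‖x‖ ≤ ‖y‖ + d := by linarith [(abs_le.1 h1).2]
  have hle' : ‖y‖ ≤ ‖x‖ + d := by linarith [(abs_le.1 h1).1]
  have hyc : (1 + ‖y‖) ^ 2 ≤ 2 * (‖y‖ ^ 2 + c) := by nlinarith [sq_nonneg (1 - ‖y‖)]
  have hxc : (1 + ‖y‖) ^ 2 ≤ 2 * (1 + d) ^ 2 * (‖x‖ ^ 2 + c) := by
    have h2 : (1 + ‖y‖) ≤ (1 + d) * (1 + ‖x‖) := by nlinarith
    have h3 : (1 + ‖x‖) ^ 2 ≤ 2 * (‖x‖ ^ 2 + c) := by nlinarith [sq_nonneg (1 - ‖x‖)]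
    calc (1 + ‖y‖) ^ 2 ≤ ((1 + d) * (1 + ‖x‖)) ^ 2 := by gcongr
      _ = (1 + d) ^ 2 * (1 + ‖x‖) ^ 2 := by ring
      _ ≤ (1 + d) ^ 2 * (2 * (‖x‖ ^ 2 + c)) := by gcongr
      _ = _ := by ring
  have hyp : 0 < ‖y‖ ^ 2 + c := by positivity
  have hxp : 0 < ‖x‖ ^ 2 + c := by positivity
  have hprod : (1 + ‖y‖) ^ 4 ≤ 4 * (1 + d) ^ 2 * ((‖y‖ ^ 2 + c) * (‖x‖ ^ 2 + c)) := by
    calc (1 + ‖y‖) ^ 4 = (1 + ‖y‖) ^ 2 * (1 + ‖y‖) ^ 2 := by ring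
      _ ≤ (2 * (‖y‖ ^ 2 + c)) * (2 * (1 + d) ^ 2 * (‖x‖ ^ 2 + c)) := by gcongr
      _ = _ := by ring
  have hnum : |‖x‖ ^ 2 - ‖y‖ ^ 2| ≤ 2 * d * (1 + d) * (1 + ‖y‖) := by
    rw [sq_sub_sq, abs_mul, abs_of_nonneg (add_nonneg hx hy)]
    have : ‖x‖ + ‖y‖ ≤ 2 * (1 + d) * (1 + ‖y‖) := by nlinarith
    calc (‖x‖ + ‖y‖) * |‖x‖ - ‖y‖| ≤ (2 * (1 + d) * (1 + ‖y‖)) * d := by gcongr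
      _ = _ := by ring
  rw [inv_sub_inv hyp.ne' hxp.ne', add_sub_add_right_eq_sub, abs_div,
    abs_of_pos (mul_pos hyp hxp), div_le_iff₀ (mul_pos hyp hxp)]
  have hyq : 0 < 1 + ‖y‖ := by positivity
  refine hnum.trans ?_
  rw [show 16 * d * (1 + d) ^ 3 * ((1 + ‖y‖)⁻¹) ^ 3 * ((‖y‖ ^ 2 + c) * (‖x‖ ^ 2 + c)) =
    16 * d * (1 + d) ^ 3 * ((‖y‖ ^ 2 + c) * (‖x‖ ^ 2 + c)) / (1 + ‖y‖) ^ 3 by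
      rw [inv_pow, div_eq_mul_inv]; ring, le_div_iff₀ (by positivity)]
  calc 2 * d * (1 + d) * (1 + ‖y‖) * (1 + ‖y‖) ^ 3 = 2 * d * (1 + d) * (1 + ‖y‖) ^ 4 := by ring
    _ ≤ 2 * d * (1 + d) * (4 * (1 + d) ^ 2 * ((‖y‖ ^ 2 + c) * (‖x‖ ^ 2 + c))) := by gcongr
    _ = 8 * (d * (1 + d) ^ 3 * ((‖y‖ ^ 2 + c) * (‖x‖ ^ 2 + c))) := by ring
    _ ≤ 16 * (d * (1 + d) ^ 3 * ((‖y‖ ^ 2 + c) * (‖x‖ ^ 2 + c))) := by gcongr; norm_num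
    _ = _ := by ring

theorem exists_abs_cellDefect_le (b : Basis (Fin 2) ℝ Plane) (p : Plane) :
    ∃ C : ℝ, ∀ c, 1 ≤ c → ∀ n,
      |cellDefect b p c n| ≤ C * ((1 + ‖latticePoint b p n‖)⁻¹) ^ 3 :=
  ⟨_, fun _ hc _ => abs_cellDefect_le (zero_lt_one.trans_le hc) fun _ hx =>
    abs_inv_norm_sq_sub_le hc (norm_sub_latticePoint_le hx)⟩

theorem tendsto_cellDefect (b : Basis (Fin 2) ℝ Plane) (p : Plane) (n : ℤ × ℤ) :
    Tendsto (fun c => cellDefect b p c n) atTop (𝓝 0) := by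
  have h : Tendsto (fun c : ℝ => 2 * c⁻¹) atTop (𝓝 0) := by
    simpa using tendsto_inv_atTop_zero.const_mul (2 : ℝ)
  refine squeeze_zero_norm' ?_ h
  filter_upwards [eventually_gt_atTop 0] with c hc
  refine abs_cellDefect_le hc fun x _ => ?_
  have hb : ∀ y : Plane, 0 ≤ (‖y‖ ^ 2 + c)⁻¹ ∧ (‖y‖ ^ 2 + c)⁻¹ ≤ c⁻¹ := fun y =>
    ⟨by positivity, by gcongr; nlinarith [norm_nonneg y]⟩
  have h1 := hb x
  have h2 := hb (latticePoint b p n)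
  rw [abs_le]
  constructor <;> linarith

/-- Dominated convergence, by the bound uniform in `c ≥ 1`. This makes the constant term of the
renormalized sum negligible at energy `-c` as `c → ∞`. -/
theorem tendsto_tsum_cellDefect (b : Basis (Fin 2) ℝ Plane) (p : Plane) :
    Tendsto (fun c => ∑' n, cellDefect b p c n) atTop (𝓝 0) := by
  obtain ⟨C, hC⟩ := exists_abs_cellDefect_le b p
  have := tendsto_tsum_of_dominated_convergence (𝓕 := atTop)
    ((summable_latticePoint b p).mul_left C) (fun n => tendsto_cellDefect b p n)
    ((eventually_ge_atTop 1).mono fun c hc n => hC c hc n)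
  simpa using this

/-- The finitely many indices of lattice points in the closed disc of radius `r`. -/
def discIndices (b : Basis (Fin 2) ℝ Plane) (p : Plane) (r : ℝ) : Finset (ℤ × ℤ) :=
  (finite_latticePoint_norm_le b p r).toFinset

@[simp]
theorem mem_discIndices {b : Basis (Fin 2) ℝ Plane} {p : Plane} {r : ℝ} {n : ℤ × ℤ} :
    n ∈ discIndices b p r ↔ ‖latticePoint b p n‖ ≤ r := by
  simp [discIndices]

theorem tendsto_discIndices (b : Basis (Fin 2) ℝ Plane) (p : Plane) :
    Tendsto (discIndices b p) atTop atTop :=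
  tendsto_atTop_finset_of_monotone
    (fun r s hrs n hn => by rw [mem_discIndices] at *; exact hn.trans hrs)
    fun n => ⟨‖latticePoint b p n‖, by simp⟩

/-- A cell stays within the distance `‖b 0‖ + ‖b 1‖` of its lattice point, so the cells attached to
a disc are squeezed between two concentric discs, whose integrals are explicit. -/
theorem sum_integral_latticeCell_bounds (b : Basis (Fin 2) ℝ Plane) (p : Plane) {c r : ℝ}
    (hc : 0 < c) (hr : ‖b 0‖ + ‖b 1‖ ≤ r) :
    Real.pi * (Real.log ((r - (‖b 0‖ + ‖b 1‖)) ^ 2 + c) - Real.log c) ≤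
        ∑ n ∈ discIndices b p r, ∫ x in latticeCell b p n, (‖x‖ ^ 2 + c)⁻¹ ∧
      ∑ n ∈ discIndices b p r, ∫ x in latticeCell b p n, (‖x‖ ^ 2 + c)⁻¹ ≤
        Real.pi * (Real.log ((r + (‖b 0‖ + ‖b 1‖)) ^ 2 + c) - Real.log c) := by
  set d := ‖b 0‖ + ‖b 1‖ with hd
  have hd0 : 0 ≤ d := by positivity
  rw [← integral_closedBall_inv_norm_sq_add hc (sub_nonneg.2 hr),
    ← integral_closedBall_inv_norm_sq_add hc (by linarith : 0 ≤ r + d),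
    ← integral_biUnion_finset _ (fun n _ => measurableSet_latticeCell b p n)
      ((pairwise_disjoint_latticeCell b p).set_pairwise _)
      (fun n _ => integrableOn_latticeCell b p n hc)]
  have hsub : (⋃ n ∈ discIndices b p r, latticeCell b p n) ⊆ Metric.closedBall 0 (r + d) := by
    intro x hx
    simp only [Set.mem_iUnion, mem_discIndices] at hx
    obtain ⟨n, hn, hxn⟩ := hx
    have h1 := norm_sub_latticePoint_le hxn
    have h2 := norm_le_norm_add_norm_sub' x (latticePoint b p n)
    rw [mem_closedBall_zero_iff]
    linarith
  have hsup : Metric.closedBall 0 (r - d) ⊆ ⋃ n ∈ discIndices b p r, latticeCell b p n := by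
    intro x hx
    rw [mem_closedBall_zero_iff] at hx
    have hxn : x ∈ latticeCell b p (⌊b.repr (x - p) 0⌋, ⌊b.repr (x - p) 1⌋) :=
      mem_latticeCell_iff.2 rfl
    simp only [Set.mem_iUnion, mem_discIndices]
    refine ⟨_, ?_, hxn⟩
    have h1 := norm_sub_latticePoint_le hxn
    have h2 := norm_le_norm_add_norm_sub x (latticePoint b p (⌊b.repr (x - p) 0⌋, ⌊b.repr (x - p) 1⌋))
    linarith
  have hint : IntegrableOn (fun x : Plane => (‖x‖ ^ 2 + c)⁻¹) (Metric.closedBall 0 (r + d)) :=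
    (continuous_inv_norm_sq_add hc).continuousOn.integrableOn_compact (isCompact_closedBall _ _)
  have hnn : ∀ s : Set Plane, 0 ≤ᵐ[volume.restrict s] fun x : Plane => (‖x‖ ^ 2 + c)⁻¹ :=
    fun s => Eventually.of_forall fun x => by change (0 : ℝ) ≤ _; positivity
  exact ⟨setIntegral_mono_set (hint.mono_set hsub) (hnn _) hsup.eventuallyLE,
    setIntegral_mono_set hint (hnn _) hsub.eventuallyLE⟩

theorem tendsto_log_add_sq_sub (d c : ℝ) :
    Tendsto (fun r : ℝ => Real.log ((r + d) ^ 2 + c) - 2 * Real.log r) atTop (𝓝 0) := by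
  have h1 : Tendsto (fun r : ℝ => (1 + d * r⁻¹) ^ 2 + c * (r⁻¹ * r⁻¹)) atTop
      (𝓝 ((1 + d * 0) ^ 2 + c * (0 * 0))) := by
    have h := tendsto_inv_atTop_zero (𝕜 := ℝ)
    exact (((h.const_mul d).const_add 1).pow 2).add ((h.mul h).const_mul c)
  have h2 := h1.log (by norm_num)
  norm_num at h2
  refine h2.congr' ?_
  have h3 := h1.eventually (lt_mem_nhds (show (0 : ℝ) < (1 + d * 0) ^ 2 + c * (0 * 0) by norm_num))
  filter_upwards [eventually_gt_atTop 0, h3] with r hr hr3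
  have : (r + d) ^ 2 + c = ((1 + d * r⁻¹) ^ 2 + c * (r⁻¹ * r⁻¹)) * r ^ 2 := by
    field_simp
  rw [this, Real.log_mul hr3.ne' (by positivity), Real.log_pow]
  push_cast
  ring_nf

/-- Asymptotics of the lattice sums of `(‖x‖² + c)⁻¹` over growing discs. -/
theorem tendsto_sum_discIndices (b : Basis (Fin 2) ℝ Plane) (p : Plane) {c : ℝ} (hc : 1 ≤ c) :
    Tendsto (fun r => ∑ n ∈ discIndices b p r, (‖latticePoint b p n‖ ^ 2 + c)⁻¹
        - 2 * Real.pi / cellArea b * Real.log r) atTop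
      (𝓝 (∑' n, cellDefect b p c n - Real.pi / cellArea b * Real.log c)) := by
  have hc0 : 0 < c := zero_lt_one.trans_le hc
  obtain ⟨C, hC⟩ := exists_abs_cellDefect_le b p
  have hsum : Summable (cellDefect b p c) :=
    Summable.of_norm_bounded ((summable_latticePoint b p).mul_left C) (hC c hc)
  have h1 := hsum.hasSum.comp (tendsto_discIndices b p)
  set d := ‖b 0‖ + ‖b 1‖ with hd
  have h2 : Tendsto (fun r => (∑ n ∈ discIndices b p r, ∫ x in latticeCell b p n, (‖x‖ ^ 2 + c)⁻¹)
      - 2 * Real.pi * Real.log r) atTop (𝓝 (-(Real.pi * Real.log c))) := by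
    -- Changing the radius by a constant does not change the limit, so the inner and the outer disc
    -- give the same value.
    have hlim : ∀ e : ℝ, Tendsto (fun r : ℝ => Real.pi * (Real.log ((r + e) ^ 2 + c) - Real.log c)
        - 2 * Real.pi * Real.log r) atTop (𝓝 (-(Real.pi * Real.log c))) := by
      intro e
      have := ((tendsto_log_add_sq_sub e c).const_mul Real.pi).sub_const (Real.pi * Real.log c)
      rw [mul_zero, zero_sub] at this
      refine this.congr fun r => ?_
      ring
    refine tendsto_of_tendsto_of_tendsto_of_le_of_le' (hlim (-d)) (hlim d) ?_ ?_
    · filter_upwards [eventually_ge_atTop d] with r hr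
      have := (sum_integral_latticeCell_bounds b p hc0 hr).1
      rw [← sub_eq_add_neg]
      linarith
    · filter_upwards [eventually_ge_atTop d] with r hr
      have := (sum_integral_latticeCell_bounds b p hc0 hr).2
      linarith
  have h3 := h1.add (h2.const_mul (cellArea b)⁻¹)
  refine (h3.congr fun r => ?_).trans_eq ?_
  · simp only [Function.comp, cellDefect, Finset.sum_sub_distrib, ← Finset.mul_sum]
    ring
  · congr 1; ring

/-! ### The dual lattice and its residue classes modulo three -/

/-- The basis of the plane formed by two vectors spanning a parallelogram of nonzero area. -/
def pairBasis (u w : Plane) (h : parallelogramArea u w ≠ 0) : Basis (Fin 2) ℝ Plane :=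
  have hb := (Basis.is_basis_iff_det (EuclideanSpace.basisFun (Fin 2) ℝ).toBasis
    (v := ![u, w])).2 (by
      rw [isUnit_iff_ne_zero, Basis.det_apply, Matrix.det_fin_two]
      simp only [Basis.toMatrix_apply, OrthonormalBasis.coe_toBasis_repr_apply,
        EuclideanSpace.basisFun_repr, Matrix.cons_val_zero, Matrix.cons_val_one]
      rw [parallelogramArea, abs_ne_zero] at h
      intro h0
      apply h
      rw [← h0]
      ring)
  Basis.mk hb.1 hb.2.ge

@[simp]
theorem pairBasis_zero (u w : Plane) (h : parallelogramArea u w ≠ 0) : pairBasis u w h 0 = u := by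
  simp [pairBasis]

@[simp]
theorem pairBasis_one (u w : Plane) (h : parallelogramArea u w ≠ 0) : pairBasis u w h 1 = w := by
  simp [pairBasis]

theorem areaB_pos {a : ℝ} (ha : 0 < a) : 0 < areaB a := by
  have h3 : (0 : ℝ) < √3 := by positivity
  have hpi := Real.pi_pos
  rw [areaB, parallelogramArea, abs_pos]
  simp only [k₁, k₂, PiLp.toLp_apply, Matrix.cons_val_zero, Matrix.cons_val_one]
  have : 0 < 4 * Real.pi / (a * √3) * (1 / 2) * (4 * Real.pi / (a * √3) * (√3 / 2)) := by positivity
  intro h0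
  linarith

theorem areaΓ_pos {a : ℝ} (ha : 0 < a) : 0 < areaΓ a := by
  have h3 : (0 : ℝ) < √3 := by positivity
  rw [areaΓ, parallelogramArea, abs_pos]
  simp only [v₁, v₂, PiLp.toLp_apply, Matrix.cons_val_zero, Matrix.cons_val_one]
  have : 0 < a * (√3 / 2) * (a * (1 / 2)) := by positivity
  intro h0
  linarith

/-- The basis `k₁, k₂` of the dual lattice. -/
def dualBasis {a : ℝ} (ha : 0 < a) : Basis (Fin 2) ℝ Plane :=
  pairBasis (k₁ a) (k₂ a) (areaB_pos ha).ne'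

theorem dualBasis_zero {a : ℝ} (ha : 0 < a) : dualBasis ha 0 = k₁ a := pairBasis_zero _ _ _

theorem dualBasis_one {a : ℝ} (ha : 0 < a) : dualBasis ha 1 = k₂ a := pairBasis_one _ _ _

theorem latticePoint_dualBasis {a : ℝ} (ha : 0 < a) (k : Plane) (m : ℤ × ℤ) :
    latticePoint (dualBasis ha) k m = ξ a m + k := by
  simp [latticePoint, dualBasis_zero, dualBasis_one, ξ]

theorem cellArea_dualBasis {a : ℝ} (ha : 0 < a) : cellArea (dualBasis ha) = areaB a := by
  simp [cellArea, dualBasis_zero, dualBasis_one, areaB]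

theorem parallelogramArea_sublattice (a : ℝ) :
    parallelogramArea ((3 : ℝ) • k₁ a) (k₂ a - k₁ a) = 3 * areaB a := by
  rw [areaB, parallelogramArea, parallelogramArea, ← abs_of_pos (three_pos (α := ℝ)), ← abs_mul,
    abs_of_pos (three_pos (α := ℝ))]
  congr 1
  simp only [PiLp.smul_apply, PiLp.sub_apply, smul_eq_mul]
  ring

/-- A basis of the index three sublattice `{ξ_m : m₁ + m₂ ≡ 0 mod 3}` of the dual lattice. -/
def subBasis {a : ℝ} (ha : 0 < a) : Basis (Fin 2) ℝ Plane :=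
  pairBasis ((3 : ℝ) • k₁ a) (k₂ a - k₁ a) (by
    rw [parallelogramArea_sublattice]
    exact (mul_pos three_pos (areaB_pos ha)).ne')

/-- Decomposition of `ℤ²` into the three classes of `m₁ + m₂` modulo three. -/
def classEquiv : Fin 3 × (ℤ × ℤ) ≃ ℤ × ℤ where
  toFun q := (q.2.1 * 3 + (q.1 : ℕ) - q.2.2, q.2.2)
  invFun m := ((Int.divModEquiv 3 (m.1 + m.2)).2, ((Int.divModEquiv 3 (m.1 + m.2)).1, m.2))
  left_inv q := by
    have h : q.2.1 * 3 + ((q.1 : ℕ) : ℤ) - q.2.2 + q.2.2 =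
        (Int.divModEquiv 3).symm (q.2.1, q.1) := by
      rw [Int.divModEquiv_symm_apply]; simp
    simp only [h, Equiv.apply_symm_apply]
  right_inv m := by
    have h := (Int.divModEquiv 3).symm_apply_apply (m.1 + m.2)
    rw [Int.divModEquiv_symm_apply] at h
    ext
    · simp only
      have h3 : ((3 : ℕ) : ℤ) = 3 := rfl
      rw [h3] at h
      linarith
    · rfl

theorem latticePoint_subBasis {a : ℝ} (ha : 0 < a) (k : Plane) (q : Fin 3 × (ℤ × ℤ)) :
    latticePoint (subBasis ha) (((q.1 : ℕ) : ℝ) • k₁ a + k) q.2 = ξ a (classEquiv q) + k := by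
  simp only [latticePoint, subBasis, pairBasis_zero, pairBasis_one, ξ, classEquiv, Equiv.coe_fn_mk]
  push_cast
  module

/-- Modulo `2π` this depends only on `m₁ + m₂` modulo 3, which is why the dual lattice is split into
three cosets of an index three sublattice. -/
theorem inner_ξ_x₀ {a : ℝ} (ha : 0 < a) (m : ℤ × ℤ) :
    inner ℝ (ξ a m) (x₀ a) = 4 * Real.pi / 3 * ((m.1 : ℝ) + m.2) := by
  have h3 : √3 ≠ 0 := by positivity
  simp only [ξ, x₀, k₁, k₂, v₁, v₂, PiLp.inner_apply, Fin.sum_univ_two, PiLp.add_apply,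
    PiLp.smul_apply, Matrix.cons_val_zero, Matrix.cons_val_one, smul_eq_mul,
    RCLike.inner_apply, conj_trivial]
  field_simp
  ring

theorem wave_zero (a : ℝ) (k : Plane) (m : ℤ × ℤ) : wave a k m 0 = 1 := by
  simp [wave]

theorem norm_wave (a : ℝ) (k : Plane) (m : ℤ × ℤ) (x : Plane) : ‖wave a k m x‖ = 1 := by
  rw [wave, mul_comm, Complex.norm_exp_ofReal_mul_I]

theorem conj_wave (a : ℝ) (k : Plane) (m : ℤ × ℤ) (x : Plane) :
    conj (wave a k m x) = wave a k m (-x) := by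
  rw [wave, wave, ← Complex.exp_conj, map_mul, Complex.conj_I, Complex.conj_ofReal, inner_neg_right]
  push_cast
  ring_nf

theorem wave_add (a : ℝ) (k : Plane) (m : ℤ × ℤ) (x y : Plane) :
    wave a k m (x + y) = wave a k m x * wave a k m y := by
  rw [wave, wave, wave, ← Complex.exp_add, inner_add_right]
  push_cast
  ring_nf

theorem wave_x₀_classEquiv {a : ℝ} (ha : 0 < a) (k : Plane) (q : Fin 3 × (ℤ × ℤ)) :
    wave a k (classEquiv q) (x₀ a) =
      Complex.exp (Complex.I * ((inner ℝ k (x₀ a) : ℝ) : ℂ)) *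
        Complex.exp (2 * Real.pi * Complex.I / 3) ^ (2 * (q.1 : ℕ)) := by
  have h1 := Complex.exp_int_mul_two_pi_mul_I (2 * q.2.1)
  rw [wave, inner_add_left, inner_ξ_x₀ ha, ← Complex.exp_nat_mul, ← Complex.exp_add,
    ← mul_one (Complex.exp (_ + _)), ← h1, ← Complex.exp_add]
  congr 1
  simp only [classEquiv, Equiv.coe_fn_mk]
  push_cast
  ring

theorem sum_phase_eq_zero :
    ∑ c : Fin 3, Complex.exp (2 * Real.pi * Complex.I / 3) ^ (2 * (c : ℕ)) = 0 := by
  have h := Complex.isPrimitiveRoot_exp 3 (by norm_num)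
  have h2 := h.geom_sum_eq_zero (by norm_num)
  have h3 := h.pow_eq_one
  push_cast at h2 h3
  rw [Finset.sum_range_succ, Finset.sum_range_succ, Finset.sum_range_one] at h2
  rw [Fin.sum_univ_three]
  simp only [Fin.val_zero, Fin.val_one, Fin.val_two, mul_zero, pow_zero, mul_one] at h2 ⊢
  linear_combination h2 + Complex.exp (2 * Real.pi * Complex.I / 3) * h3

theorem cutoffSum_eq_sum {a : ℝ} (ha : 0 < a) (k : Plane) (f : ℤ × ℤ → ℂ) (r : ℝ) :
    cutoffSum a k f r = ∑ m ∈ discIndices (dualBasis ha) k r, f m := by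
  rw [cutoffSum, tsum_eq_sum (s := discIndices (dualBasis ha) k r)]
  · refine Finset.sum_congr rfl fun m hm => if_pos ?_
    rwa [mem_discIndices, latticePoint_dualBasis] at hm
  · intro m hm
    rw [mem_discIndices, latticePoint_dualBasis] at hm
    exact if_neg hm

theorem cutoffSum_eq_sum_class {a : ℝ} (ha : 0 < a) (k : Plane) (f : ℤ × ℤ → ℂ) (r : ℝ) :
    cutoffSum a k f r = ∑ c : Fin 3,
      ∑ n ∈ discIndices (subBasis ha) (((c : ℕ) : ℝ) • k₁ a + k) r, f (classEquiv (c, n)) := by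
  rw [cutoffSum_eq_sum ha, Finset.sum_sigma']
  symm
  refine Finset.sum_bij (fun q _ => classEquiv (q.1, q.2)) ?_ ?_ ?_ ?_
  · intro q hq
    simp only [Finset.mem_sigma, Finset.mem_univ, true_and, mem_discIndices] at hq
    rw [mem_discIndices, latticePoint_dualBasis, ← latticePoint_subBasis ha]
    exact hq
  · rintro ⟨c, n⟩ _ ⟨c', n'⟩ _ h
    have := classEquiv.injective h
    simp only [Prod.mk.injEq] at this
    obtain ⟨rfl, rfl⟩ := this
    rfl
  · intro m hm
    refine ⟨⟨(classEquiv.symm m).1, (classEquiv.symm m).2⟩, ?_, by simp⟩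
    simp only [Finset.mem_sigma, Finset.mem_univ, true_and, mem_discIndices]
    rw [latticePoint_subBasis ha, Equiv.apply_symm_apply, ← latticePoint_dualBasis ha]
    exact mem_discIndices.1 hm
  · intro q _
    rfl

/-! ### Green sums at large negative energy -/

/-- The disc partial sums of the series defining `g`. -/
def greenSum (a : ℝ) (l : ℝ) (x k : Plane) (r : ℝ) : ℂ :=
  cutoffSum a k (fun m => wave a k m x / ((freeEigenvalue a k m : ℂ) - (l : ℂ))) r

/-- The coefficient of `Real.log c` does not depend on `k`; only the vanishing error `D` does. Hence
the divergent parts cancel when two quasi-momenta are compared. -/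
theorem exists_tendsto_greenSum_zero {a : ℝ} (ha : 0 < a) (k : Plane) :
    ∃ D : ℝ → ℝ, Tendsto D atTop (𝓝 0) ∧ ∀ c, 1 ≤ c →
      Tendsto (fun r : ℝ => greenSum a (-c) 0 k r
        - ((2 * Real.pi / areaB a * Real.log r : ℝ) : ℂ)) atTop
        (𝓝 ((D c - Real.pi / areaB a * Real.log c : ℝ) : ℂ)) := by
  refine ⟨_, tendsto_tsum_cellDefect (dualBasis ha) k, fun c hc => ?_⟩
  have h := (tendsto_sum_discIndices (dualBasis ha) k hc).ofReal
  rw [cellArea_dualBasis] at h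
  refine h.congr fun r => ?_
  rw [greenSum, cutoffSum_eq_sum ha, Complex.ofReal_sub, Complex.ofReal_sum]
  congr 1
  refine Finset.sum_congr rfl fun m _ => ?_
  rw [wave_zero, latticePoint_dualBasis, freeEigenvalue]
  push_cast
  rw [sub_neg_eq_add, one_div]

/-- On each coset of the sublattice the phase is constant, and the three phases add up to zero. All
cosets have the same logarithmic terms in `r` and in `c`, so both cancel and only cell defects
survive. -/
theorem exists_tendsto_greenSum_x₀ {a : ℝ} (ha : 0 < a) (k : Plane) :
    ∃ D : ℝ → ℂ, Tendsto D atTop (𝓝 0) ∧ ∀ c, 1 ≤ c →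
      Tendsto (greenSum a (-c) (x₀ a) k) atTop (𝓝 (D c)) := by
  set w : Fin 3 → ℂ := fun j => Complex.exp (Complex.I * ((inner ℝ k (x₀ a) : ℝ) : ℂ)) *
        Complex.exp (2 * Real.pi * Complex.I / 3) ^ (2 * (j : ℕ)) with hw
  have hw0 : ∑ j, w j = 0 := by rw [hw, ← Finset.mul_sum, sum_phase_eq_zero, mul_zero]
  set p : Fin 3 → Plane := fun j => ((j : ℕ) : ℝ) • k₁ a + k with hp
  refine ⟨fun c => ∑ j : Fin 3, w j *
    ((∑' n, cellDefect (subBasis ha) (p j) c n : ℝ) : ℂ), ?_, fun c hc => ?_⟩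
  · have h := tendsto_finsetSum (Finset.univ : Finset (Fin 3)) fun j _ =>
      (tendsto_tsum_cellDefect (subBasis ha) (p j)).ofReal.const_mul (w j)
    simpa using h
  · have h := tendsto_finsetSum (Finset.univ : Finset (Fin 3)) fun j _ =>
      (tendsto_sum_discIndices (subBasis ha) (p j) hc).ofReal.const_mul (w j)
    simp only [Complex.ofReal_sub, mul_sub, Finset.sum_sub_distrib, ← Finset.sum_mul, hw0, zero_mul,
      sub_zero] at h
    refine h.congr fun r => ?_
    rw [greenSum, cutoffSum_eq_sum_class ha]
    refine Finset.sum_congr rfl fun j _ => ?_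
    rw [Complex.ofReal_sum, Finset.mul_sum]
    refine Finset.sum_congr rfl fun n _ => ?_
    rw [wave_x₀_classEquiv ha, freeEigenvalue, ← latticePoint_subBasis ha]
    push_cast
    rw [sub_neg_eq_add, div_eq_mul_inv]

/-! ### Resolvent differences and existence of the Green function -/

theorem freeEigenvalue_nonneg (a : ℝ) (k : Plane) (m : ℤ × ℤ) : 0 ≤ freeEigenvalue a k m := by
  rw [freeEigenvalue]; positivity

theorem notMem_range_freeEigenvalue_of_neg {a l : ℝ} (k : Plane) (hl : l < 0) :
    l ∉ Set.range (freeEigenvalue a k) := by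
  rintro ⟨m, hm⟩
  linarith [freeEigenvalue_nonneg a k m]

theorem ofReal_freeEigenvalue_sub_ne_zero {a l : ℝ} {k : Plane}
    (hl : l ∉ Set.range (freeEigenvalue a k)) (m : ℤ × ℤ) :
    (freeEigenvalue a k m : ℂ) - (l : ℂ) ≠ 0 := by
  rw [← Complex.ofReal_sub, Complex.ofReal_ne_zero, sub_ne_zero]
  exact fun h => hl ⟨m, h⟩

theorem eventually_le_abs_freeEigenvalue_sub {a : ℝ} (ha : 0 < a) (k : Plane) (l : ℝ) :
    ∀ᶠ m in cofinite, (1 + ‖ξ a m + k‖) ^ 2 / 4 ≤ |freeEigenvalue a k m - l| := by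
  refine (finite_latticePoint_norm_le (dualBasis ha) k (1 + |l|)).subset fun m hm => ?_
  rw [Set.mem_ofPred_eq, latticePoint_dualBasis]
  by_contra! hlt
  refine hm ?_
  change (1 + ‖ξ a m + k‖) ^ 2 / 4 ≤ |freeEigenvalue a k m - l|
  refine le_trans ?_ (le_abs_self _)
  rw [freeEigenvalue]
  have h1 := le_abs_self l
  have h2 := abs_nonneg l
  nlinarith [sq_nonneg (1 - ‖ξ a m + k‖), sq_nonneg |l|]

theorem summable_inv_abs_mul_inv_abs {a : ℝ} (ha : 0 < a) (k : Plane) (l l' : ℝ) :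
    Summable fun m => |freeEigenvalue a k m - l|⁻¹ * |freeEigenvalue a k m - l'|⁻¹ := by
  have h := (summable_latticePoint (dualBasis ha) k).mul_left 16
  simp only [latticePoint_dualBasis] at h
  refine Summable.of_norm_bounded_eventually h ?_
  filter_upwards [eventually_le_abs_freeEigenvalue_sub ha k l,
    eventually_le_abs_freeEigenvalue_sub ha k l'] with m h1 h2
  have hp : 0 < 1 + ‖ξ a m + k‖ := by positivity
  rw [Real.norm_of_nonneg (by positivity)]
  calc |freeEigenvalue a k m - l|⁻¹ * |freeEigenvalue a k m - l'|⁻¹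
      ≤ ((1 + ‖ξ a m + k‖) ^ 2 / 4)⁻¹ * ((1 + ‖ξ a m + k‖) ^ 2 / 4)⁻¹ := by gcongr
    _ = 16 * ((1 + ‖ξ a m + k‖)⁻¹) ^ 3 * (1 + ‖ξ a m + k‖)⁻¹ := by field_simp; norm_num
    _ ≤ 16 * ((1 + ‖ξ a m + k‖)⁻¹) ^ 3 * 1 := by
        gcongr
        exact inv_le_one_of_one_le₀ (by linarith [norm_nonneg (ξ a m + k)])
    _ = _ := mul_one _

theorem norm_wave_div (a : ℝ) (k x : Plane) (l l' : ℝ) (m : ℤ × ℤ) :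
    ‖wave a k m x / (((freeEigenvalue a k m : ℂ) - (l : ℂ)) *
      ((freeEigenvalue a k m : ℂ) - (l' : ℂ)))‖ =
      |freeEigenvalue a k m - l|⁻¹ * |freeEigenvalue a k m - l'|⁻¹ := by
  rw [norm_div, norm_wave, norm_mul, ← Complex.ofReal_sub, ← Complex.ofReal_sub,
    Complex.norm_real, Complex.norm_real, one_div, mul_inv, Real.norm_eq_abs, Real.norm_eq_abs]

theorem summable_wave_div {a : ℝ} (ha : 0 < a) (k x : Plane) (l l' : ℝ) :
    Summable fun m => wave a k m x / (((freeEigenvalue a k m : ℂ) - (l : ℂ)) *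
      ((freeEigenvalue a k m : ℂ) - (l' : ℂ))) := by
  refine Summable.of_norm ?_
  simp only [norm_wave_div]
  exact summable_inv_abs_mul_inv_abs ha k l l'

/-- The absolutely convergent series of `e^{i(ξ_m + k)·x} / ((|ξ_m + k|² - l)(|ξ_m + k|² - l'))`. -/
def resolventSum (a : ℝ) (l l' : ℝ) (x k : Plane) : ℂ :=
  ∑' m, wave a k m x / (((freeEigenvalue a k m : ℂ) - (l : ℂ)) *
      ((freeEigenvalue a k m : ℂ) - (l' : ℂ)))

/-- Termwise this is `1/(E - l) - 1/(E - l') = (l - l')/((E - l)(E - l'))`, which turns a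
conditionally convergent or divergent series into an absolutely convergent one. -/
theorem tendsto_greenSum_sub {a : ℝ} (ha : 0 < a) {k : Plane} (x : Plane) {l l' : ℝ}
    (hl : l ∉ Set.range (freeEigenvalue a k)) (hl' : l' ∉ Set.range (freeEigenvalue a k)) :
    Tendsto (fun r => greenSum a l x k r - greenSum a l' x k r) atTop
      (𝓝 (((l : ℂ) - l') * resolventSum a l l' x k)) := by
  have h := ((summable_wave_div ha k x l l').hasSum.comp
    (tendsto_discIndices (dualBasis ha) k)).const_mul ((l : ℂ) - l')
  refine h.congr fun r => ?_
  rw [greenSum, greenSum, cutoffSum_eq_sum ha, cutoffSum_eq_sum ha, ← Finset.sum_sub_distrib,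
    Function.comp, Finset.mul_sum]
  refine Finset.sum_congr rfl fun m _ => ?_
  have h1 := ofReal_freeEigenvalue_sub_ne_zero hl m
  have h2 := ofReal_freeEigenvalue_sub_ne_zero hl' m
  field_simp
  ring

theorem zero_mem_triangularLattice (a : ℝ) : (0 : Plane) ∈ triangularLattice a :=
  ⟨(0, 0), by simp⟩

theorem x₀_notMem_triangularLattice {a : ℝ} (ha : 0 < a) : x₀ a ∉ triangularLattice a := by
  rintro ⟨m, hm⟩
  have h3 : (√3 : ℝ) ≠ 0 := by positivity
  have h0 := congrArg (fun v : Plane => v 0) hm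
  have h1 := congrArg (fun v : Plane => v 1) hm
  simp only [x₀, v₁, v₂, PiLp.add_apply, PiLp.smul_apply, Matrix.cons_val_zero,
    Matrix.cons_val_one, smul_eq_mul] at h0 h1
  have e1 : (m.1 : ℝ) = m.2 := by
    have : (m.1 - m.2 : ℝ) * a = 0 := by linarith
    have := (mul_eq_zero.1 this).resolve_right ha.ne'
    linarith
  have e0 : 3 * ((m.1 : ℝ) + m.2) = 4 := by
    have : (3 * ((m.1 : ℝ) + m.2) - 4) * (a * √3) = 0 := by linarith
    have := (mul_eq_zero.1 this).resolve_right (mul_ne_zero ha.ne' h3)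
    linarith
  have e0' : 3 * (m.1 + m.2) = 4 := by exact_mod_cast e0
  omega

theorem neg_mem_triangularLattice {a : ℝ} {x : Plane} (h : -x ∈ triangularLattice a) :
    x ∈ triangularLattice a := by
  obtain ⟨m, hm⟩ := h
  refine ⟨(-m.1, -m.2), ?_⟩
  rw [← neg_neg x, ← hm]
  push_cast
  module

theorem g_zero_eq {a l : ℝ} {k : Plane} {V : ℂ}
    (h : Tendsto (fun r : ℝ => greenSum a l 0 k r
        - ((2 * Real.pi / areaB a * Real.log r : ℝ) : ℂ)) atTop (𝓝 V)) :
    g a l 0 k = (areaΓ a : ℂ)⁻¹ * V := by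
  rw [g, if_pos (zero_mem_triangularLattice a), ← h.limUnder_eq]
  simp only [greenSum, wave_zero]

theorem g_eq {a l : ℝ} {k x : Plane} {V : ℂ} (hx : x ∉ triangularLattice a)
    (h : Tendsto (greenSum a l x k) atTop (𝓝 V)) : g a l x k = (areaΓ a : ℂ)⁻¹ * V := by
  rw [g, if_neg hx, ← h.limUnder_eq]
  rfl

theorem conj_greenSum {a : ℝ} (ha : 0 < a) (l : ℝ) (x k : Plane) (r : ℝ) :
    conj (greenSum a l x k r) = greenSum a l (-x) k r := by
  rw [greenSum, greenSum, cutoffSum_eq_sum ha, cutoffSum_eq_sum ha, map_sum]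
  refine Finset.sum_congr rfl fun m _ => ?_
  rw [map_div₀, conj_wave, map_sub, Complex.conj_ofReal, Complex.conj_ofReal]

/-- The differences of the positions of the two scatterers. -/
def IsScattererDifference (a : ℝ) (x : Plane) : Prop := x = 0 ∨ x = x₀ a ∨ x = -x₀ a

theorem IsScattererDifference.neg {a : ℝ} {x : Plane} (h : IsScattererDifference a x) :
    IsScattererDifference a (-x) := by
  rcases h with rfl | rfl | rfl
  · exact Or.inl neg_zero
  · exact Or.inr (Or.inr rfl)
  · exact Or.inr (Or.inl (neg_neg _))

theorem isScattererDifference_sub (a : ℝ) (i j : Fin 2) :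
    IsScattererDifference a (scatterer a i - scatterer a j) := by
  fin_cases i <;> fin_cases j <;> simp [scatterer, IsScattererDifference]

open Classical in
/-- The coefficient of the logarithm by which the series defining `g` is renormalized. -/
def logCoeff (a : ℝ) (x : Plane) : ℝ := if x = 0 then 2 * Real.pi / areaB a else 0

/-- The renormalized disc partial sums of the series defining `g`. -/
def renormalizedSum (a : ℝ) (l : ℝ) (x k : Plane) (r : ℝ) : ℂ :=
  greenSum a l x k r - ((logCoeff a x * Real.log r : ℝ) : ℂ)

theorem conj_renormalizedSum {a : ℝ} (ha : 0 < a) (l : ℝ) (x k : Plane) (r : ℝ) :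
    conj (renormalizedSum a l x k r) = renormalizedSum a l (-x) k r := by
  simp only [renormalizedSum, logCoeff, map_sub, conj_greenSum ha, Complex.conj_ofReal, neg_eq_zero]

theorem renormalizedSum_x₀ {a : ℝ} (ha : 0 < a) (l : ℝ) (k : Plane) :
    renormalizedSum a l (x₀ a) k = greenSum a l (x₀ a) k := by
  have h : x₀ a ≠ 0 := fun h =>
    x₀_notMem_triangularLattice ha (h ▸ zero_mem_triangularLattice a)
  ext r
  simp [renormalizedSum, logCoeff, h]

theorem renormalizedSum_zero (a l : ℝ) (k : Plane) (r : ℝ) : renormalizedSum a l 0 k r =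
    greenSum a l 0 k r - ((2 * Real.pi / areaB a * Real.log r : ℝ) : ℂ) := by
  simp [renormalizedSum, logCoeff]

theorem exists_tendsto_renormalizedSum_neg_one {a : ℝ} (ha : 0 < a) (k : Plane) {x : Plane}
    (hx : IsScattererDifference a x) :
    ∃ V : ℂ, Tendsto (renormalizedSum a (-1) x k) atTop (𝓝 V) := by
  obtain ⟨D, _, hD⟩ := exists_tendsto_greenSum_x₀ ha k
  have h := hD 1 le_rfl
  rw [← renormalizedSum_x₀ ha] at h
  rcases hx with rfl | rfl | rfl
  · obtain ⟨D, _, hD⟩ := exists_tendsto_greenSum_zero ha k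
    exact ⟨_, (hD 1 le_rfl).congr fun r => (renormalizedSum_zero a (-1) k r).symm⟩
  · exact ⟨_, h⟩
  · exact ⟨_, ((Complex.continuous_conj.tendsto _).comp h).congr fun r =>
      conj_renormalizedSum ha (-1) (x₀ a) k r⟩

theorem g_eq_of_tendsto {a : ℝ} (ha : 0 < a) {k x : Plane} (hx : IsScattererDifference a x)
    {l : ℝ} {V : ℂ} (h : Tendsto (renormalizedSum a l x k) atTop (𝓝 V)) :
    g a l x k = (areaΓ a : ℂ)⁻¹ * V := by
  have hx₀ := x₀_notMem_triangularLattice ha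
  rcases hx with rfl | rfl | rfl
  · exact g_zero_eq (h.congr fun r => renormalizedSum_zero a l k r)
  · rw [renormalizedSum_x₀ ha] at h
    exact g_eq hx₀ h
  · refine g_eq (fun h' => hx₀ (neg_mem_triangularLattice h')) (h.congr fun r => ?_)
    rw [← conj_renormalizedSum ha, renormalizedSum_x₀ ha, conj_greenSum ha]

theorem tendsto_renormalizedSum_sub {a : ℝ} (ha : 0 < a) {k : Plane} (x : Plane) {l l' : ℝ}
    (hl : l ∉ Set.range (freeEigenvalue a k)) (hl' : l' ∉ Set.range (freeEigenvalue a k)) :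
    Tendsto (fun r => renormalizedSum a l x k r - renormalizedSum a l' x k r) atTop
      (𝓝 (((l : ℂ) - l') * resolventSum a l l' x k)) :=
  (tendsto_greenSum_sub ha x hl hl').congr fun _ => (sub_sub_sub_cancel_right _ _ _).symm

/-- Convergence is known at energy `-1` from the cell comparison, and the resolvent difference
carries it to every `l` off the free spectrum. -/
theorem exists_tendsto_renormalizedSum {a : ℝ} (ha : 0 < a) {k : Plane} {x : Plane}
    (hx : IsScattererDifference a x) {l : ℝ} (hl : l ∉ Set.range (freeEigenvalue a k)) :
    ∃ V : ℂ, Tendsto (renormalizedSum a l x k) atTop (𝓝 V) := by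
  obtain ⟨V, hV⟩ := exists_tendsto_renormalizedSum_neg_one ha k hx
  have h := (tendsto_renormalizedSum_sub ha x hl
    (notMem_range_freeEigenvalue_of_neg k neg_one_lt_zero)).add hV
  exact ⟨_, h.congr fun r => sub_add_cancel _ _⟩

theorem g_sub_g {a : ℝ} (ha : 0 < a) {k x : Plane} (hx : IsScattererDifference a x) {l l' : ℝ}
    (hl : l ∉ Set.range (freeEigenvalue a k)) (hl' : l' ∉ Set.range (freeEigenvalue a k)) :
    g a l x k - g a l' x k = (areaΓ a : ℂ)⁻¹ * (((l : ℂ) - l') * resolventSum a l l' x k) := by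
  obtain ⟨V, hV⟩ := exists_tendsto_renormalizedSum ha hx hl
  obtain ⟨V', hV'⟩ := exists_tendsto_renormalizedSum ha hx hl'
  rw [g_eq_of_tendsto ha hx hV, g_eq_of_tendsto ha hx hV', ← mul_sub,
    tendsto_nhds_unique (hV.sub hV') (tendsto_renormalizedSum_sub ha x hl hl')]

theorem conj_g {a : ℝ} (ha : 0 < a) {k x : Plane} (hx : IsScattererDifference a x) {l : ℝ}
    (hl : l ∉ Set.range (freeEigenvalue a k)) : conj (g a l x k) = g a l (-x) k := by
  obtain ⟨V, hV⟩ := exists_tendsto_renormalizedSum ha hx hl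
  have hc := ((Complex.continuous_conj.tendsto _).comp hV).congr fun r =>
    conj_renormalizedSum ha l x k r
  rw [g_eq_of_tendsto ha hx hV, g_eq_of_tendsto ha hx.neg hc, map_mul, map_inv₀,
    Complex.conj_ofReal]

/-! ### Theta series and the heat kernel bound -/

/-- The terms `e^{-t(κn+q)² + i(κn+q)x}` of a one-dimensional theta series. -/
def thetaTerm (t κ q x : ℝ) (n : ℤ) : ℂ :=
  Complex.exp (-(t * (κ * n + q) ^ 2 : ℝ) + Complex.I * ((κ * n + q) * x : ℝ))

theorem norm_thetaTerm (t κ q x : ℝ) (n : ℤ) :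
    ‖thetaTerm t κ q x n‖ = Real.exp (-(t * (κ * n + q) ^ 2)) := by
  rw [thetaTerm, Complex.norm_exp, ← Complex.ofReal_neg, Complex.add_re, Complex.ofReal_re,
    Complex.I_mul_re, Complex.ofReal_im, neg_zero, add_zero]

theorem summable_exp_neg_mul_add_sq {c : ℝ} (hc : 0 < c) (y : ℝ) :
    Summable fun n : ℤ => Real.exp (-(c * ((n : ℝ) + y) ^ 2)) := by
  have h := ((summable_jacobiTheta₂_term_iff (Complex.I * ((c * y / Real.pi : ℝ) : ℂ))
    (Complex.I * ((c / Real.pi : ℝ) : ℂ))).2 (by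
      rw [Complex.I_mul_im, Complex.ofReal_re]; positivity)).norm.mul_left (Real.exp (-(c * y ^ 2)))
  refine h.congr fun n => ?_
  rw [norm_jacobiTheta₂_term, Complex.I_mul_im, Complex.I_mul_im, Complex.ofReal_re,
    Complex.ofReal_re, ← Real.exp_add]
  congr 1
  have := Real.pi_pos.ne'
  field_simp
  ring

theorem summable_norm_thetaTerm {t κ : ℝ} (ht : 0 < t) (hκ : 0 < κ) (q x : ℝ) :
    Summable fun n => ‖thetaTerm t κ q x n‖ := by
  refine (summable_exp_neg_mul_add_sq (c := t * κ ^ 2) (by positivity) (q / κ)).congr fun n => ?_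
  rw [norm_thetaTerm]
  congr 1
  field_simp

/-- The sum of a one-dimensional theta series. -/
def thetaSum (t κ q x : ℝ) : ℂ := ∑' n : ℤ, thetaTerm t κ q x n

/-- By Poisson summation, a theta series is largest at zero quasi-momentum. -/
theorem exists_thetaSum_bound {t κ : ℝ} (ht : 0 < t) (hκ : 0 < κ) :
    ∃ B : ℝ → ℝ, (∀ x, 0 ≤ B x) ∧ (∀ x, thetaSum t κ 0 x = B x) ∧
      ∀ q x, ‖thetaSum t κ q x‖ ≤ B x := by
  have hpi := Real.pi_pos
  obtain ⟨A, hA⟩ : ∃ A : ℝ, A = t * κ ^ 2 / Real.pi := ⟨_, rfl⟩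
  have hA0 : 0 < A := by rw [hA]; positivity
  have hsum : ∀ x : ℝ,
      Summable fun n : ℤ => Real.exp (-(Real.pi / A * ((n : ℝ) + -(κ * x / (2 * Real.pi))) ^ 2)) :=
    fun x => summable_exp_neg_mul_add_sq (by positivity) _
  have hAc : (1 : ℂ) / (A : ℂ) ^ (1 / 2 : ℂ) = ((1 / A ^ (1 / 2 : ℝ) : ℝ) : ℂ) := by
    rw [Complex.ofReal_div, Complex.ofReal_cpow hA0.le]
    push_cast
    rfl
  -- Poisson summation: on the dual side `x` shifts the Gaussians along the real axis and `q` shifts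
  -- them along the imaginary axis.
  have hpoisson : ∀ q x : ℝ, thetaSum t κ q x =
      Complex.exp (-(t * q ^ 2 : ℝ) + Complex.I * (q * x : ℝ)) *
        ((1 / A ^ (1 / 2 : ℝ) : ℝ) * ∑' n : ℤ, Complex.exp (-Real.pi / A *
          (n + Complex.I * ((-2 * t * κ * q + Complex.I * (κ * x)) / (2 * Real.pi))) ^ 2)) := by
    intro q x
    rw [← hAc, ← Complex.tsum_exp_neg_quadratic (by simpa using hA0), ← tsum_mul_left, thetaSum]
    congr 1
    ext n
    rw [thetaTerm, ← Complex.exp_add]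
    congr 1
    have : (Real.pi : ℂ) ≠ 0 := Complex.ofReal_ne_zero.2 hpi.ne'
    rw [hA]
    push_cast
    field_simp
    ring
  refine ⟨fun x => 1 / A ^ (1 / 2 : ℝ) *
    ∑' n : ℤ, Real.exp (-(Real.pi / A * ((n : ℝ) + -(κ * x / (2 * Real.pi))) ^ 2)),
    fun x => ?_, fun x => ?_, fun q x => ?_⟩
  · exact mul_nonneg (by positivity) (tsum_nonneg fun n => (Real.exp_pos _).le)
  · rw [hpoisson, Complex.ofReal_mul (1 / A ^ (1 / 2 : ℝ)), Complex.ofReal_tsum]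
    simp only [zero_mul, mul_zero, ne_eq, OfNat.ofNat_ne_zero, not_false_eq_true, zero_pow,
      Complex.ofReal_zero, neg_zero, zero_add, add_zero, Complex.exp_zero, one_mul]
    congr 2
    ext n
    rw [Complex.ofReal_exp]
    congr 1
    push_cast
    linear_combination (-(Real.pi : ℂ) / A) *
      ((2 * n * (κ * x / (2 * Real.pi)) +
        (Complex.I ^ 2 - 1) * (κ * x / (2 * Real.pi)) ^ 2 : ℂ)) * Complex.I_sq
  -- The imaginary shift only produces a phase and a factor `e^{tq²}` independent of `n`; the
  -- prefactor `e^{-tq²}` will cancel it exactly, leaving the sum of Gaussians for `q = 0`.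
  · have hterm : ∀ n : ℤ, ‖Complex.exp (-Real.pi / A *
          (n + Complex.I * ((-2 * t * κ * q + Complex.I * (κ * x)) / (2 * Real.pi))) ^ 2)‖ =
        Real.exp (t * q ^ 2) *
          Real.exp (-(Real.pi / A * ((n : ℝ) + -(κ * x / (2 * Real.pi))) ^ 2)) := by
      intro n
      have hz : (-Real.pi / A *
          (n + Complex.I * ((-2 * t * κ * q + Complex.I * (κ * x)) / (2 * Real.pi))) ^ 2 : ℂ) =
          ((t * q ^ 2 + -(Real.pi / A * ((n : ℝ) + -(κ * x / (2 * Real.pi))) ^ 2) : ℝ) : ℂ) +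
          ((2 * Real.pi / A * ((n : ℝ) + -(κ * x / (2 * Real.pi))) * (t * κ * q / Real.pi) : ℝ) : ℂ)
            * Complex.I := by
        have h1 : (t * q ^ 2 : ℝ) = Real.pi / A * (t * κ * q / Real.pi) ^ 2 := by
          rw [hA]; field_simp
        have h2 : (n + Complex.I * ((-2 * t * κ * q + Complex.I * (κ * x)) / (2 * Real.pi)) : ℂ) =
            (((n : ℝ) + -(κ * x / (2 * Real.pi)) : ℝ) : ℂ) -
              Complex.I * ((t * κ * q / Real.pi : ℝ) : ℂ) := by
          push_cast
          linear_combination (κ * x / (2 * Real.pi)) * Complex.I_sq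
        rw [h1, h2]
        push_cast
        linear_combination (-(Real.pi : ℂ) / A * (t * κ * q / Real.pi) ^ 2) * Complex.I_sq
      rw [hz, Complex.norm_exp, ← Real.exp_add, Complex.add_re, Complex.ofReal_re,
        Complex.re_ofReal_mul, Complex.I_re, mul_zero, add_zero]
    rw [hpoisson, norm_mul, norm_mul, Complex.norm_exp, Complex.norm_real,
      Real.norm_of_nonneg (by positivity)]
    have hb := norm_tsum_le_tsum_norm (f := fun n : ℤ => Complex.exp (-Real.pi / A *
      (n + Complex.I * ((-2 * t * κ * q + Complex.I * (κ * x)) / (2 * Real.pi))) ^ 2))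
      (((hsum x).mul_left _).congr fun n => (hterm n).symm)
    simp only [hterm, tsum_mul_left] at hb
    have he : (-(t * q ^ 2 : ℝ) + Complex.I * (q * x : ℝ) : ℂ).re = -(t * q ^ 2) := by
      rw [← Complex.ofReal_neg, Complex.add_re, Complex.ofReal_re, Complex.I_mul_re,
        Complex.ofReal_im, neg_zero, add_zero]
    rw [he]
    calc _ ≤ Real.exp (-(t * q ^ 2)) * (1 / A ^ (1 / 2 : ℝ) * (Real.exp (t * q ^ 2) *
          ∑' n : ℤ, Real.exp (-(Real.pi / A * ((n : ℝ) + -(κ * x / (2 * Real.pi))) ^ 2)))) := by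
          gcongr
      _ = (Real.exp (-(t * q ^ 2)) * Real.exp (t * q ^ 2)) * (1 / A ^ (1 / 2 : ℝ) *
          ∑' n : ℤ, Real.exp (-(Real.pi / A * ((n : ℝ) + -(κ * x / (2 * Real.pi))) ^ 2))) := by ring
      _ = _ := by rw [← Real.exp_add, neg_add_cancel, Real.exp_zero, one_mul]

theorem exp_int_mul_pi_mul_thetaTerm (t : ℝ) {κ : ℝ} (hκ : 0 < κ) (q x : ℝ) (n : ℤ) :
    Complex.exp (Complex.I * (Real.pi * n : ℝ)) * thetaTerm t κ q x n =
      Complex.exp (-(Complex.I * (Real.pi * q / κ : ℝ))) *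
        thetaTerm t κ q (x + Real.pi / κ) n := by
  rw [thetaTerm, thetaTerm, ← Complex.exp_add, ← Complex.exp_add]
  congr 1
  have : (κ : ℂ) ≠ 0 := Complex.ofReal_ne_zero.2 hκ.ne'
  push_cast
  field_simp
  ring

/-- The theta series over pairs of integers of equal parity. -/
theorem tsum_thetaTerm_same_parity {t κ κ' : ℝ} (ht : 0 < t) (hκ : 0 < κ) (hκ' : 0 < κ')
    (q q' x x' : ℝ) :
    ∑' m : ℤ × ℤ, thetaTerm t κ q x (m.1 + m.2) * thetaTerm t κ' q' x' (m.1 - m.2) =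
      (thetaSum t κ q x * thetaSum t κ' q' x' +
        Complex.exp (-(Complex.I * (Real.pi * q / κ : ℝ))) *
          Complex.exp (-(Complex.I * (Real.pi * q' / κ' : ℝ))) *
          (thetaSum t κ q (x + Real.pi / κ) * thetaSum t κ' q' (x' + Real.pi / κ'))) / 2 := by
  have hs := summable_norm_thetaTerm ht hκ q
  have hs' := summable_norm_thetaTerm ht hκ' q'
  have hp := fun y y' => summable_mul_of_summable_norm (hs y) (hs' y')
  set u := Complex.exp (-(Complex.I * (Real.pi * q / κ : ℝ))) *
          Complex.exp (-(Complex.I * (Real.pi * q' / κ' : ℝ))) with hu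
  let e : ℤ × ℤ → ℤ × ℤ := fun m => (m.1 + m.2, m.1 - m.2)
  have he : Function.Injective e := by
    intro m n h
    simp only [e, Prod.mk.injEq] at h
    ext <;> omega
  let f : ℤ × ℤ → ℂ := fun m => (thetaTerm t κ q x m.1 * thetaTerm t κ' q' x' m.2 +
    u * (thetaTerm t κ q (x + Real.pi / κ) m.1 * thetaTerm t κ' q' (x' + Real.pi / κ') m.2)) / 2
  -- The factor `(1 + (-1)^(m₁ + m₂)) / 2` projects onto pairs of equal parity, the range of `e`. Up
  -- to a phase, the sign `(-1)^n` amounts to shifting `x` by `π / κ`.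
  have hf : ∀ m, f m = (1 + Complex.exp (Complex.I * (Real.pi * (m.1 + m.2 : ℤ) : ℝ))) / 2 *
      (thetaTerm t κ q x m.1 * thetaTerm t κ' q' x' m.2) := by
    intro m
    have h1 := exp_int_mul_pi_mul_thetaTerm t hκ q x m.1
    have h2 := exp_int_mul_pi_mul_thetaTerm t hκ' q' x' m.2
    have h3 : Complex.exp (Complex.I * (Real.pi * (m.1 + m.2 : ℤ) : ℝ)) =
        Complex.exp (Complex.I * (Real.pi * m.1 : ℝ)) *
          Complex.exp (Complex.I * (Real.pi * m.2 : ℝ)) := by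
      rw [← Complex.exp_add]; congr 1; push_cast; ring
    calc f m = (thetaTerm t κ q x m.1 * thetaTerm t κ' q' x' m.2 +
          (Complex.exp (-(Complex.I * (Real.pi * q / κ : ℝ))) *
            thetaTerm t κ q (x + Real.pi / κ) m.1) *
          (Complex.exp (-(Complex.I * (Real.pi * q' / κ' : ℝ))) *
            thetaTerm t κ' q' (x' + Real.pi / κ') m.2)) / 2 := by simp only [f, hu]; ring
      _ = _ := by rw [← h1, ← h2, h3]; ring
  have hsupp : Function.support f ⊆ Set.range e := by
    intro m hm
    by_contra hr
    apply hm
    have hodd : Odd (m.1 + m.2) := by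
      rw [← Int.not_even_iff_odd]
      rintro ⟨j, hj⟩
      exact hr ⟨(j, m.1 - j), by ext <;> simp only [e] <;> omega⟩
    obtain ⟨j, hj⟩ := hodd
    have hexp : Complex.exp (Complex.I * (Real.pi * (m.1 + m.2 : ℤ) : ℝ)) = -1 := by
      have := Complex.exp_int_mul_two_pi_mul_I j
      rw [hj, show Complex.I * (Real.pi * (2 * j + 1 : ℤ) : ℝ) =
        (j : ℂ) * (2 * Real.pi * Complex.I) + Real.pi * Complex.I by push_cast; ring,
        Complex.exp_add, this, Complex.exp_pi_mul_I, one_mul]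
    rw [hf, hexp]
    ring
  have hfe : ∀ m, f (e m) =
      thetaTerm t κ q x (m.1 + m.2) * thetaTerm t κ' q' x' (m.1 - m.2) := by
    intro m
    have hexp : Complex.exp (Complex.I * (Real.pi * ((e m).1 + (e m).2 : ℤ) : ℝ)) = 1 := by
      have := Complex.exp_int_mul_two_pi_mul_I m.1
      rw [← this]
      congr 1
      simp only [e]
      push_cast
      ring
    rw [hf, hexp]
    simp only [e]
    ring
  rw [← tsum_congr hfe, he.tsum_eq hsupp]
  simp only [f]
  rw [tsum_div_const, (hp x x').tsum_add ((hp _ _).mul_left u), tsum_mul_left, thetaSum, thetaSum,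
    thetaSum, thetaSum, tsum_mul_tsum_of_summable_norm (hs _) (hs' _),
    tsum_mul_tsum_of_summable_norm (hs _) (hs' _)]

/-- The terms of the heat kernel of the torus at quasi-momentum `k`. -/
def heatTerm (a t : ℝ) (k x : Plane) (m : ℤ × ℤ) : ℂ :=
  wave a k m x * (Real.exp (-(t * freeEigenvalue a k m)) : ℝ)

/-- In Cartesian coordinates `ξ_m` has components proportional to `m₁ + m₂` and `m₁ - m₂`, so the
heat kernel factors into theta series up to the parity constraint linking these two integers. -/
theorem heatTerm_eq (a t : ℝ) (k x : Plane) (m : ℤ × ℤ) :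
    heatTerm a t k x m =
      thetaTerm t (4 * Real.pi / (a * √3) * (1 / 2)) (k 0) (x 0) (m.1 + m.2) *
        thetaTerm t (4 * Real.pi / (a * √3) * (√3 / 2)) (k 1) (x 1) (m.1 - m.2) := by
  rw [heatTerm, wave, thetaTerm, thetaTerm, Complex.ofReal_exp, ← Complex.exp_add,
    ← Complex.exp_add, freeEigenvalue, EuclideanSpace.real_norm_sq_eq]
  congr 1
  simp only [ξ, k₁, k₂, PiLp.inner_apply, Fin.sum_univ_two, PiLp.add_apply,
    PiLp.smul_apply, Matrix.cons_val_zero, Matrix.cons_val_one, smul_eq_mul,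
    RCLike.inner_apply, conj_trivial]
  push_cast
  ring

theorem summable_heatTerm {a t : ℝ} (ha : 0 < a) (ht : 0 < t) (k x : Plane) :
    Summable (heatTerm a t k x) := by
  have hpi := Real.pi_pos
  have h3 : (0 : ℝ) < √3 := by positivity
  have he : Function.Injective fun m : ℤ × ℤ => (m.1 + m.2, m.1 - m.2) := by
    intro m n h
    simp only [Prod.mk.injEq] at h
    ext <;> omega
  refine ((summable_mul_of_summable_norm
    (summable_norm_thetaTerm ht (κ := 4 * Real.pi / (a * √3) * (1 / 2)) (by positivity) (k 0) (x 0))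
    (summable_norm_thetaTerm ht (κ := 4 * Real.pi / (a * √3) * (√3 / 2)) (by positivity)
      (k 1) (x 1))).comp_injective he).congr fun m => ?_
  rw [heatTerm_eq]
  rfl

/-- The heat kernel is largest at zero quasi-momentum. -/
theorem norm_tsum_heatTerm_le {a t : ℝ} (ha : 0 < a) (ht : 0 < t) (k x : Plane) :
    ‖∑' m, heatTerm a t k x m‖ ≤ (∑' m, heatTerm a t 0 x m).re := by
  have hpi := Real.pi_pos
  have h3 : (0 : ℝ) < √3 := by positivity
  simp only [heatTerm_eq]
  set κ := 4 * Real.pi / (a * √3) * (1 / 2) with hκ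
  set κ' := 4 * Real.pi / (a * √3) * (√3 / 2) with hκ'
  have hκ0 : 0 < κ := by positivity
  have hκ'0 : 0 < κ' := by positivity
  obtain ⟨B, hB0, hBe, hB⟩ := exists_thetaSum_bound ht hκ0
  obtain ⟨B', hB0', hBe', hB'⟩ := exists_thetaSum_bound ht hκ'0
  rw [tsum_thetaTerm_same_parity ht hκ0 hκ'0, tsum_thetaTerm_same_parity ht hκ0 hκ'0]
  simp only [PiLp.zero_apply, hBe, hBe', mul_zero, zero_div, Complex.ofReal_zero, neg_zero,
    Complex.exp_zero, one_mul]
  rw [show (((B (x 0) : ℂ) * B' (x 1) + B (x 0 + Real.pi / κ) * B' (x 1 + Real.pi / κ')) / 2).re =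
    (B (x 0) * B' (x 1) + B (x 0 + Real.pi / κ) * B' (x 1 + Real.pi / κ')) / 2 by
      rw [← Complex.ofReal_re ((B (x 0) * B' (x 1) + B (x 0 + Real.pi / κ) *
        B' (x 1 + Real.pi / κ')) / 2)]
      push_cast
      rfl]
  have hu : ∀ y : ℝ, ‖Complex.exp (-(Complex.I * (y : ℂ)))‖ = 1 := by
    intro y
    rw [Complex.norm_exp]
    simp
  rw [norm_div, Complex.norm_two]
  gcongr
  refine (norm_add_le _ _).trans ?_
  rw [norm_mul, norm_mul, norm_mul, norm_mul, hu, hu, one_mul, one_mul]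
  gcongr
  · exact hB0 _
  · exact hB _ _
  · exact hB' _ _
  · exact hB0 _
  · exact hB _ _
  · exact hB' _ _

/-! ### From the heat kernel to resolvent differences -/

theorem integrableOn_exp_sub_exp {l l' E : ℝ} (hl : l < E) (hl' : l' < E) :
    IntegrableOn (fun t => Real.exp ((l - E) * t) - Real.exp ((l' - E) * t)) (Set.Ioi 0) :=
  (integrableOn_exp_mul_Ioi (sub_neg.2 hl) 0).sub (integrableOn_exp_mul_Ioi (sub_neg.2 hl') 0)

theorem integral_exp_sub_exp {l l' E : ℝ} (hl : l < E) (hl' : l' < E) :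
    ∫ t in Set.Ioi (0 : ℝ), (Real.exp ((l - E) * t) - Real.exp ((l' - E) * t)) =
      (l - l') * ((E - l)⁻¹ * (E - l')⁻¹) := by
  rw [integral_sub (integrableOn_exp_mul_Ioi (sub_neg.2 hl) 0)
    (integrableOn_exp_mul_Ioi (sub_neg.2 hl') 0), integral_exp_mul_Ioi (sub_neg.2 hl),
    integral_exp_mul_Ioi (sub_neg.2 hl'), mul_zero, mul_zero, Real.exp_zero]
  have h1 : l - E ≠ 0 := (sub_neg.2 hl).ne
  have h2 : l' - E ≠ 0 := (sub_neg.2 hl').ne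
  have h3 : E - l ≠ 0 := (sub_pos.2 hl).ne'
  have h4 : E - l' ≠ 0 := (sub_pos.2 hl').ne'
  rw [← neg_sub l E, ← neg_sub l' E]
  field_simp
  ring

theorem hasSum_re_mul_resolventSum {a : ℝ} (ha : 0 < a) (l l' : ℝ) (x k : Plane) (u : ℂ) :
    HasSum (fun m => (u * wave a k m x).re *
      ((freeEigenvalue a k m - l)⁻¹ * (freeEigenvalue a k m - l')⁻¹))
      (u * resolventSum a l l' x k).re := by
  refine (Complex.hasSum_re ((summable_wave_div ha k x l l').hasSum.mul_left u)).congr_fun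
    (fun m => ?_)
  rw [mul_div_assoc', div_eq_mul_inv, ← Complex.ofReal_sub, ← Complex.ofReal_sub,
    ← Complex.ofReal_mul, ← Complex.ofReal_inv, Complex.re_mul_ofReal, mul_inv]

/-- The resolvent differences are largest at zero quasi-momentum. -/
theorem re_mul_resolventSum_le {a : ℝ} (ha : 0 < a) {l l' : ℝ} (hl : l < 0) (hl' : l' < l)
    (x k : Plane) {u : ℂ} (hu : ‖u‖ ≤ 1) :
    (u * resolventSum a l l' x k).re ≤ (resolventSum a l l' x 0).re := by
  have hE : ∀ k m, l < freeEigenvalue a k m := fun k m => hl.trans_le (freeEigenvalue_nonneg a k m)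
  have hE' : ∀ k m, l' < freeEigenvalue a k m := fun k m => hl'.trans (hE k m)
  let φ : Plane → ℤ × ℤ → ℝ → ℝ := fun k m t =>
    Real.exp ((l - freeEigenvalue a k m) * t) - Real.exp ((l' - freeEigenvalue a k m) * t)
  have hφi : ∀ k m, IntegrableOn (φ k m) (Set.Ioi 0) := fun k m =>
    integrableOn_exp_sub_exp (hE k m) (hE' k m)
  have hφ0 : ∀ k m t, 0 < t → 0 ≤ φ k m t := by
    intro k m t ht
    refine sub_nonneg.2 (Real.exp_le_exp.2 ?_)
    gcongr
  let F : ℤ × ℤ → ℝ → ℝ := fun m t =>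
    (wave a 0 m x).re * φ 0 m t - (u * wave a k m x).re * φ k m t
  have hFi : ∀ m, Integrable (F m) (volume.restrict (Set.Ioi 0)) := fun m =>
    ((hφi 0 m).const_mul _).sub ((hφi k m).const_mul _)
  have hre : ∀ z : ℂ, ‖z‖ ≤ 1 → |z.re| ≤ 1 := fun z hz => (Complex.abs_re_le_norm z).trans hz
  have huw : ∀ m, |(u * wave a k m x).re| ≤ 1 := fun m => hre _ (by
    rw [norm_mul, norm_wave, mul_one]; exact hu)
  have hw : ∀ m, |(wave a 0 m x).re| ≤ 1 := fun m => hre _ (norm_wave a 0 m x).le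
  have hsum : ∀ k, Summable fun m => ∫ t in Set.Ioi (0 : ℝ), φ k m t := by
    intro k
    refine ((summable_inv_abs_mul_inv_abs ha k l l').mul_left (l - l')).congr fun m => ?_
    rw [integral_exp_sub_exp (hE k m) (hE' k m), abs_of_pos (sub_pos.2 (hE k m)),
      abs_of_pos (sub_pos.2 (hE' k m))]
  -- The weight difference decays like `1/E²` after integration, which justifies exchanging sum and
  -- integral; a single exponential would give the non-summable `1/E`.
  have hFs : Summable fun m => ∫ t in Set.Ioi (0 : ℝ), ‖F m t‖ := by
    refine Summable.of_nonneg_of_le (fun m => integral_nonneg fun t => norm_nonneg _) (fun m => ?_)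
      ((hsum 0).add (hsum k))
    rw [← integral_add (hφi 0 m) (hφi k m)]
    refine setIntegral_mono_on (hFi m).norm ((hφi 0 m).add (hφi k m)) measurableSet_Ioi
      fun t ht => ?_
    refine (norm_sub_le _ _).trans ?_
    rw [norm_mul, norm_mul, Real.norm_of_nonneg (hφ0 0 m t ht), Real.norm_of_nonneg (hφ0 k m t ht),
      Real.norm_eq_abs, Real.norm_eq_abs]
    exact add_le_add (mul_le_of_le_one_left (hφ0 0 m t ht) (hw m))
      (mul_le_of_le_one_left (hφ0 k m t ht) (huw m))
  have h1 := hasSum_integral_of_summable_integral_norm hFi hFs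
  have h2 : HasSum (fun m => ∫ t in Set.Ioi (0 : ℝ), F m t)
      ((l - l') * ((resolventSum a l l' x 0).re - (u * resolventSum a l l' x k).re)) := by
    have h := ((hasSum_re_mul_resolventSum ha l l' x 0 1).sub
      (hasSum_re_mul_resolventSum ha l l' x k u)).mul_left (l - l')
    simp only [one_mul] at h
    refine h.congr_fun fun m => ?_
    rw [integral_sub ((hφi 0 m).const_mul _) ((hφi k m).const_mul _), integral_const_mul,
      integral_const_mul, integral_exp_sub_exp (hE 0 m) (hE' 0 m),
      integral_exp_sub_exp (hE k m) (hE' k m)]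
    ring
  -- For each `t` the integrand is the nonnegative weight `e^{lt} - e^{l't}` times the gap in the
  -- heat kernel inequality.
  have h3 : 0 ≤ ∫ t in Set.Ioi (0 : ℝ), ∑' m, F m t := by
    refine setIntegral_nonneg measurableSet_Ioi fun t ht => ?_
    rw [Set.mem_Ioi] at ht
    have hs := (Complex.hasSum_re (summable_heatTerm ha ht 0 x).hasSum).sub
      (Complex.hasSum_re ((summable_heatTerm ha ht k x).hasSum.mul_left u))
    have hs' := hs.mul_left (Real.exp (l * t) - Real.exp (l' * t))
    have hF : ∀ m, F m t = (Real.exp (l * t) - Real.exp (l' * t)) *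
        ((heatTerm a t 0 x m).re - (u * heatTerm a t k x m).re) := by
      intro m
      simp only [F, φ, heatTerm]
      rw [← mul_assoc u, Complex.re_mul_ofReal, Complex.re_mul_ofReal]
      have h (c k) : Real.exp ((c - freeEigenvalue a k m) * t) =
          Real.exp (c * t) * Real.exp (-(t * freeEigenvalue a k m)) := by
        rw [← Real.exp_add]; congr 1; ring
      rw [h, h, h, h]
      ring
    rw [tsum_congr hF, hs'.tsum_eq]
    refine mul_nonneg (sub_nonneg.2 (Real.exp_le_exp.2 (by gcongr))) (sub_nonneg.2 ?_)
    refine (Complex.re_le_norm _).trans ?_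
    rw [norm_mul]
    exact (mul_le_of_le_one_left (norm_nonneg _) hu).trans (norm_tsum_heatTerm_le ha ht k x)
  rw [← h2.unique h1] at h3
  exact sub_nonneg.1 (nonneg_of_mul_nonneg_right h3 (sub_pos.2 hl'))

/-- Choose `u` as the phase that rotates the sum at `k` onto the nonnegative real axis. -/
theorem norm_resolventSum_le {a : ℝ} (ha : 0 < a) {l l' : ℝ} (hl : l < 0) (hl' : l' < l)
    (x k : Plane) : ‖resolventSum a l l' x k‖ ≤ (resolventSum a l l' x 0).re := by
  obtain ⟨u, hu, h⟩ : ∃ u : ℂ, ‖u‖ ≤ 1 ∧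
      (u * resolventSum a l l' x k).re = ‖resolventSum a l l' x k‖ := by
    by_cases h0 : resolventSum a l l' x k = 0
    · exact ⟨0, by simp, by simp [h0]⟩
    · have hn : ‖resolventSum a l l' x k‖ ≠ 0 := norm_ne_zero_iff.2 h0
      refine ⟨conj (resolventSum a l l' x k) / ‖resolventSum a l l' x k‖, ?_, ?_⟩
      · rw [norm_div, RCLike.norm_conj, Complex.norm_real, norm_norm, div_self hn]
      · rw [div_mul_eq_mul_div, Complex.conj_mul', ← Complex.ofReal_pow, ← Complex.ofReal_div,
          Complex.ofReal_re, sq, mul_div_assoc, div_self hn, mul_one]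
  rw [← h]
  exact re_mul_resolventSum_le ha hl hl' x k hu

/-! ### The top eigenvalue is largest at zero quasi-momentum -/

/-- The value of `g` at the lattice points, which is real. -/
def g₀ (a : ℝ) (k : Plane) (l : ℝ) : ℝ := (g a l 0 k).re

/-- The largest eigenvalue of the matrix of values of `g` at the scatterers. -/
def topEigenvalue (a : ℝ) (k : Plane) (l : ℝ) : ℝ := g₀ a k l + ‖g a l (x₀ a) k‖

theorem isScattererDifference_zero (a : ℝ) : IsScattererDifference a 0 := Or.inl rfl

theorem isScattererDifference_x₀ (a : ℝ) : IsScattererDifference a (x₀ a) := Or.inr (Or.inl rfl)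

theorem ofReal_g₀ {a : ℝ} (ha : 0 < a) {k : Plane} {l : ℝ}
    (hl : l ∉ Set.range (freeEigenvalue a k)) : (g₀ a k l : ℂ) = g a l 0 k := by
  have h := conj_g ha (isScattererDifference_zero a) hl
  rw [neg_zero] at h
  exact Complex.conj_eq_iff_re.1 h

theorem exists_g₀_eq {a : ℝ} (ha : 0 < a) (k : Plane) :
    ∃ D : ℝ → ℝ, Tendsto D atTop (𝓝 0) ∧ ∀ c, 1 ≤ c →
      g₀ a k (-c) = (areaΓ a)⁻¹ * (D c - Real.pi / areaB a * Real.log c) := by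
  obtain ⟨D, h0, hD⟩ := exists_tendsto_greenSum_zero ha k
  refine ⟨D, h0, fun c hc => ?_⟩
  rw [g₀, g_zero_eq (hD c hc), ← Complex.ofReal_inv, ← Complex.ofReal_mul, Complex.ofReal_re]

theorem tendsto_g_x₀ {a : ℝ} (ha : 0 < a) (k : Plane) :
    Tendsto (fun c : ℝ => g a (-c) (x₀ a) k) atTop (𝓝 0) := by
  obtain ⟨D, h0, hD⟩ := exists_tendsto_greenSum_x₀ ha k
  have h := h0.const_mul (areaΓ a : ℂ)⁻¹
  rw [mul_zero] at h
  refine h.congr' ?_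
  filter_upwards [eventually_ge_atTop 1] with c hc
  rw [g_eq (x₀_notMem_triangularLattice ha) (hD c hc)]

/-- The term `-Real.log c`, with a positive coefficient, dominates: the remaining diagonal error and
the off-diagonal entry both vanish in the limit. -/
theorem tendsto_topEigenvalue {a : ℝ} (ha : 0 < a) (k : Plane) :
    Tendsto (fun c : ℝ => topEigenvalue a k (-c)) atTop atBot := by
  obtain ⟨D, h0, hD⟩ := exists_g₀_eq ha k
  have h1 := (h0.const_mul (areaΓ a)⁻¹).add (tendsto_g_x₀ ha k).norm
  have h2 : Tendsto (fun c : ℝ => -((areaΓ a)⁻¹ * (Real.pi / areaB a) * Real.log c)) atTop atBot := by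
    refine tendsto_neg_atTop_atBot.comp (Real.tendsto_log_atTop.const_mul_atTop ?_)
    have := areaΓ_pos ha
    have := areaB_pos ha
    have := Real.pi_pos
    positivity
  refine (h1.add_atBot h2).congr' ?_
  filter_upwards [eventually_ge_atTop 1] with c hc
  rw [topEigenvalue, hD c hc]
  ring

/-- The increments of both entries from `-c` to `l` are dominated by those at `k = 0`. As `c → ∞`
the boundary terms disappear: the logarithms are common to both quasi-momenta, and the off-diagonal
entries tend to zero. -/
theorem topEigenvalue_le_zero_momentum {a : ℝ} (ha : 0 < a) (k : Plane) {l : ℝ} (hl : l < 0) :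
    topEigenvalue a k l ≤ topEigenvalue a 0 l := by
  have hA := areaΓ_pos ha
  have hreg : ∀ (k : Plane) {l : ℝ}, l < 0 → l ∉ Set.range (freeEigenvalue a k) :=
    fun k l hl => notMem_range_freeEigenvalue_of_neg k hl
  have hcmp : ∀ x, IsScattererDifference a x → ∀ l' < l,
      ‖g a l x k - g a l' x k‖ ≤ (g a l x 0 - g a l' x 0).re := by
    intro x hx l' hl'
    rw [g_sub_g ha hx (hreg k hl) (hreg k (hl'.trans hl)),
      g_sub_g ha hx (hreg 0 hl) (hreg 0 (hl'.trans hl)), ← Complex.ofReal_inv,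
      ← Complex.ofReal_sub, Complex.re_ofReal_mul, Complex.re_ofReal_mul, norm_mul, norm_mul,
      Complex.norm_real, Complex.norm_real, Real.norm_of_nonneg (inv_pos.2 hA).le,
      Real.norm_of_nonneg (sub_pos.2 hl').le]
    have := norm_resolventSum_le ha hl hl' x k
    have := sub_pos.2 hl'
    gcongr
  obtain ⟨D, hD0, hD⟩ := exists_g₀_eq ha k
  obtain ⟨D', hD0', hD'⟩ := exists_g₀_eq ha 0
  have hlim : Tendsto (fun c : ℝ => topEigenvalue a 0 l + ((areaΓ a)⁻¹ * D c - (areaΓ a)⁻¹ * D' c +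
      (‖g a (-c) (x₀ a) k‖ + ‖g a (-c) (x₀ a) 0‖))) atTop (𝓝 (topEigenvalue a 0 l)) := by
    have h := (((hD0.const_mul (areaΓ a)⁻¹).sub (hD0'.const_mul (areaΓ a)⁻¹)).add
      ((tendsto_g_x₀ ha k).norm.add (tendsto_g_x₀ ha 0).norm)).const_add (topEigenvalue a 0 l)
    simpa using h
  refine ge_of_tendsto hlim ?_
  filter_upwards [eventually_ge_atTop 1, eventually_gt_atTop (-l)] with c hc hcl
  have hc' : -c < l := by linarith
  have h1 : g₀ a k l - g₀ a k (-c) ≤ g₀ a 0 l - g₀ a 0 (-c) := by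
    have := (Complex.re_le_norm _).trans (hcmp 0 (isScattererDifference_zero a) (-c) hc')
    simpa [g₀] using this
  rw [hD c hc, hD' c hc] at h1
  have h2 := hcmp _ (isScattererDifference_x₀ a) (-c) hc'
  have h3 := norm_le_norm_add_norm_sub' (g a l (x₀ a) k) (g a (-c) (x₀ a) k)
  have h4 := (Complex.re_le_norm _).trans (norm_sub_le (g a l (x₀ a) 0) (g a (-c) (x₀ a) 0))
  rw [topEigenvalue, topEigenvalue]
  linarith

/-! ### Dependence on the energy below the free spectrum -/

/-- The sum of `1 / (||ξ_m + k|² - l| ||ξ_m + k|² - l'|)`. -/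
def absResolventSum (a : ℝ) (k : Plane) (l l' : ℝ) : ℝ :=
  ∑' m, |freeEigenvalue a k m - l|⁻¹ * |freeEigenvalue a k m - l'|⁻¹

theorem norm_resolventSum_le_abs {a : ℝ} (ha : 0 < a) (k x : Plane) (l l' : ℝ) :
    ‖resolventSum a l l' x k‖ ≤ absResolventSum a k l l' := by
  have h := norm_tsum_le_tsum_norm (summable_wave_div ha k x l l').norm
  simp only [norm_wave_div] at h
  exact h

theorem absResolventSum_nonneg (a : ℝ) (k : Plane) (l l' : ℝ) : 0 ≤ absResolventSum a k l l' :=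
  tsum_nonneg fun m => by positivity

theorem freeEigenvalue_zero (a : ℝ) (k : Plane) : freeEigenvalue a k 0 = ‖k‖ ^ 2 := by
  simp [freeEigenvalue, ξ]

/-- This is the only use of the Brillouin zone: on it the mode `m = 0` is the lowest free one. -/
theorem sq_norm_le_freeEigenvalue {a : ℝ} {k : Plane} (hk : k ∈ brillouinZone a) (m : ℤ × ℤ) :
    ‖k‖ ^ 2 ≤ freeEigenvalue a k m := by
  have h := hk (-m.1, -m.2)
  have h2 : k - ξ a (-m.1, -m.2) = ξ a m + k := by
    simp only [ξ]; push_cast; module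
  rw [h2] at h
  rw [freeEigenvalue]
  gcongr

theorem zero_mem_brillouinZone (a : ℝ) : (0 : Plane) ∈ brillouinZone a := fun m => by simp

theorem notMem_range_of_lt {a : ℝ} {k : Plane} (hk : k ∈ brillouinZone a) {l : ℝ}
    (hl : l < ‖k‖ ^ 2) : l ∉ Set.range (freeEigenvalue a k) := by
  rintro ⟨m, hm⟩
  linarith [sq_norm_le_freeEigenvalue hk m]

theorem re_resolventSum_zero {a : ℝ} (ha : 0 < a) {k : Plane} (hk : k ∈ brillouinZone a)
    {l l' : ℝ} (hl : l < ‖k‖ ^ 2) (hl' : l' < ‖k‖ ^ 2) :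
    (resolventSum a l l' 0 k).re = absResolventSum a k l l' := by
  have h := hasSum_re_mul_resolventSum ha l l' 0 k 1
  simp only [one_mul, wave_zero, Complex.one_re] at h
  rw [← h.tsum_eq, absResolventSum]
  congr 1
  ext m
  have := sq_norm_le_freeEigenvalue hk m
  rw [abs_of_pos (by linarith), abs_of_pos (by linarith)]

theorem norm_g_sub_g_le {a : ℝ} (ha : 0 < a) {k x : Plane} (hx : IsScattererDifference a x)
    {l l' : ℝ} (hl : l ∉ Set.range (freeEigenvalue a k))
    (hl' : l' ∉ Set.range (freeEigenvalue a k)) :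
    ‖g a l x k - g a l' x k‖ ≤ (areaΓ a)⁻¹ * (|l - l'| * absResolventSum a k l l') := by
  have hA := areaΓ_pos ha
  rw [g_sub_g ha hx hl hl', ← Complex.ofReal_inv, ← Complex.ofReal_sub, norm_mul, norm_mul,
    Complex.norm_real, Complex.norm_real, Real.norm_of_nonneg (inv_pos.2 hA).le, Real.norm_eq_abs]
  have := norm_resolventSum_le_abs ha k x l l'
  gcongr

theorem g₀_sub_g₀ {a : ℝ} (ha : 0 < a) {k : Plane} (hk : k ∈ brillouinZone a)
    {l l' : ℝ} (hl : l < ‖k‖ ^ 2) (hl' : l' < ‖k‖ ^ 2) :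
    g₀ a k l - g₀ a k l' = (areaΓ a)⁻¹ * ((l - l') * absResolventSum a k l l') := by
  rw [g₀, g₀, ← Complex.sub_re, g_sub_g ha (isScattererDifference_zero a) (notMem_range_of_lt hk hl)
    (notMem_range_of_lt hk hl'), ← Complex.ofReal_inv, ← Complex.ofReal_sub, Complex.re_ofReal_mul,
    Complex.re_ofReal_mul, re_resolventSum_zero ha hk hl hl']

/-- Waves have modulus one, so the off-diagonal entry changes by at most the increase of the
diagonal one, where all terms are positive. -/
theorem topEigenvalue_mono {a : ℝ} (ha : 0 < a) {k : Plane} (hk : k ∈ brillouinZone a)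
    {l l' : ℝ} (hl : l < ‖k‖ ^ 2) (hl' : l' ≤ l) : topEigenvalue a k l' ≤ topEigenvalue a k l := by
  have hl'' := hl'.trans_lt hl
  have h1 := g₀_sub_g₀ ha hk hl hl''
  have h2 := norm_g_sub_g_le ha (isScattererDifference_x₀ a) (notMem_range_of_lt hk hl)
    (notMem_range_of_lt hk hl'')
  rw [abs_of_nonneg (sub_nonneg.2 hl')] at h2
  have h3 := norm_le_norm_add_norm_sub (g a l (x₀ a) k) (g a l' (x₀ a) k)
  rw [topEigenvalue, topEigenvalue]
  linarith

theorem continuousOn_topEigenvalue {a : ℝ} (ha : 0 < a) {k : Plane} (hk : k ∈ brillouinZone a)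
    {q : ℝ} (hq : q < ‖k‖ ^ 2) : ContinuousOn (topEigenvalue a k) (Set.Iic q) := by
  have hA := inv_pos.2 (areaΓ_pos ha)
  have hQ := absResolventSum_nonneg a k q q
  have hle : ∀ l ≤ q, ∀ l' ≤ q, absResolventSum a k l l' ≤ absResolventSum a k q q := by
    intro l hl l' hl'
    refine (summable_inv_abs_mul_inv_abs ha k l l').tsum_le_tsum (fun m => ?_)
      (summable_inv_abs_mul_inv_abs ha k q q)
    have := sq_norm_le_freeEigenvalue hk m
    have hq0 : 0 < freeEigenvalue a k m - q := by linarith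
    have h1 : freeEigenvalue a k m - q ≤ freeEigenvalue a k m - l := by linarith
    have h2 : freeEigenvalue a k m - q ≤ freeEigenvalue a k m - l' := by linarith
    rw [abs_of_pos hq0, abs_of_pos (hq0.trans_le h1), abs_of_pos (hq0.trans_le h2)]
    have : 0 ≤ freeEigenvalue a k m - l' := (hq0.trans_le h2).le
    gcongr
  have hL : ∀ x, IsScattererDifference a x → ∀ l ≤ q, ∀ l' ≤ q, ‖g a l x k - g a l' x k‖ ≤
      ((areaΓ a)⁻¹ * absResolventSum a k q q) * |l - l'| := by
    intro x hx l hl l' hl'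
    refine (norm_g_sub_g_le ha hx (notMem_range_of_lt hk (hl.trans_lt hq))
      (notMem_range_of_lt hk (hl'.trans_lt hq))).trans ?_
    rw [mul_assoc, mul_comm (absResolventSum a k q q)]
    have := hle l hl l' hl'
    gcongr
  have hc : ∀ x, IsScattererDifference a x → ContinuousOn (fun l => g a l x k) (Set.Iic q) := by
    intro x hx
    refine (LipschitzOnWith.of_dist_le_mul
      (K := ⟨(areaΓ a)⁻¹ * absResolventSum a k q q, by positivity⟩) fun l hl l' hl' => ?_).continuousOn
    rw [dist_eq_norm, Real.dist_eq]
    exact hL x hx l hl l' hl'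
  exact (Complex.continuous_re.comp_continuousOn (hc 0 (isScattererDifference_zero a))).add
    (hc _ (isScattererDifference_x₀ a)).norm

/-- The mode `m = 0` has a pole at `‖k‖ ^ 2`. Rotating the off-diagonal series by the conjugate
phase `u` of that mode makes both poles add up, while every other mode contributes a nonnegative
amount. -/
theorem exists_lt_topEigenvalue {a : ℝ} (ha : 0 < a) {k : Plane} (hk : k ∈ brillouinZone a)
    (α : ℝ) : ∃ l < ‖k‖ ^ 2, α < topEigenvalue a k l := by
  have hA := areaΓ_pos ha
  set e := ‖k‖ ^ 2 with he
  set u := conj (wave a k 0 (x₀ a)) with hu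
  have hnu : ‖u‖ = 1 := by rw [hu, RCLike.norm_conj, norm_wave]
  set K := g₀ a k (e - 1) + (u * g a (e - 1) (x₀ a) k).re with hK
  have hlow : ∀ l, e - 1 < l → l < e →
      K + (areaΓ a)⁻¹ * ((l - (e - 1)) * (2 * (e - l)⁻¹)) ≤ topEigenvalue a k l := by
    intro l hl1 hl
    have hl0 : e - 1 < e := by linarith
    have hs := (hasSum_re_mul_resolventSum ha l (e - 1) 0 k 1).add
      (hasSum_re_mul_resolventSum ha l (e - 1) (x₀ a) k u)
    simp only [one_mul, wave_zero, Complex.one_re] at hs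
    have hge := le_hasSum hs 0 fun m _ => by
      have hm := sq_norm_le_freeEigenvalue hk m
      have h1 : |(u * wave a k m (x₀ a)).re| ≤ 1 := by
        refine (Complex.abs_re_le_norm _).trans ?_
        rw [norm_mul, hnu, norm_wave, one_mul]
      have h2 : 0 ≤ 1 + (u * wave a k m (x₀ a)).re := by linarith [(abs_le.1 h1).1]
      rw [← one_mul ((freeEigenvalue a k m - l)⁻¹ * _), ← mul_assoc, one_mul]
      have h3 : 0 < freeEigenvalue a k m - l := by linarith
      have h4 : 0 < freeEigenvalue a k m - (e - 1) := by linarith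
      have h5 : 0 ≤ (freeEigenvalue a k m - l)⁻¹ * (freeEigenvalue a k m - (e - 1))⁻¹ := by
        positivity
      nlinarith [mul_nonneg h2 h5]
    have hu1 : (u * wave a k 0 (x₀ a)).re = 1 := by
      rw [hu, Complex.conj_mul', norm_wave]; simp
    rw [freeEigenvalue_zero, hu1, ← he, sub_sub_cancel, inv_one, mul_one] at hge
    have hd0 := congrArg Complex.re (g_sub_g ha (isScattererDifference_zero a)
      (notMem_range_of_lt hk hl) (notMem_range_of_lt hk hl0))
    have hd1 := congrArg (fun z => (u * z).re) (g_sub_g ha (isScattererDifference_x₀ a)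
      (notMem_range_of_lt hk hl) (notMem_range_of_lt hk hl0))
    simp only [mul_left_comm u] at hd1
    rw [← Complex.ofReal_inv, ← Complex.ofReal_sub, Complex.re_ofReal_mul, Complex.re_ofReal_mul]
      at hd0 hd1
    rw [mul_sub, Complex.sub_re] at hd1
    rw [Complex.sub_re] at hd0
    have hn : (u * g a l (x₀ a) k).re ≤ ‖g a l (x₀ a) k‖ := by
      refine (Complex.re_le_norm _).trans ?_
      rw [norm_mul, hnu, one_mul]
    have hmul : (areaΓ a)⁻¹ * ((l - (e - 1)) * (2 * (e - l)⁻¹)) ≤ (areaΓ a)⁻¹ * ((l - (e - 1)) *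
        ((resolventSum a l (e - 1) 0 k).re + (u * resolventSum a l (e - 1) (x₀ a) k).re)) := by
      have : 0 ≤ l - (e - 1) := by linarith
      gcongr
      linarith
    rw [topEigenvalue, hK, g₀, g₀]
    linarith
  -- With `l = e - 1/(N + 1)` the factor `(l - (e - 1)) * (2 / (e - l))` equals `2 * N`, so the
  -- lower bound becomes `K + |α - K| + 1 > α`.
  set N := areaΓ a * (|α - K| + 1) / 2 with hN
  have hN0 : 0 < N := by positivity
  have hε : (N + 1)⁻¹ < 1 := inv_lt_one_of_one_lt₀ (by linarith)
  have hε0 : 0 < (N + 1)⁻¹ := by positivity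
  refine ⟨e - (N + 1)⁻¹, by linarith, ?_⟩
  refine lt_of_lt_of_le ?_ (hlow (e - (N + 1)⁻¹) (by linarith) (by linarith))
  have : (areaΓ a)⁻¹ * ((e - (N + 1)⁻¹ - (e - 1)) * (2 * (e - (e - (N + 1)⁻¹))⁻¹)) =
      |α - K| + 1 := by
    rw [sub_sub_cancel, inv_inv]
    have : (e - (N + 1)⁻¹ - (e - 1)) * (2 * (N + 1)) = 2 * N := by field_simp; ring
    rw [this, hN]
    field_simp
  rw [this]
  linarith [le_abs_self (α - K)]

/-- The point where `α` is first reached by the largest eigenvalue of the matrix of values of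
`g`. -/
theorem exists_first_crossing {a : ℝ} (ha : 0 < a) {k : Plane} (hk : k ∈ brillouinZone a) (α : ℝ) :
    ∃ c < ‖k‖ ^ 2, topEigenvalue a k c = α ∧ ∀ l < c, topEigenvalue a k l < α := by
  obtain ⟨q, hq, hαq⟩ := exists_lt_topEigenvalue ha hk α
  obtain ⟨c, hc, hcq⟩ := (((tendsto_topEigenvalue ha k).eventually (eventually_lt_atBot α)).and
    (eventually_ge_atTop (-q))).exists
  have hpq : -c ≤ q := by linarith
  have hcont := (continuousOn_topEigenvalue ha hk hq).mono (Set.Icc_subset_Iic_self (a := -c))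
  obtain ⟨z, hz, hzα⟩ := intermediate_value_Icc hpq hcont ⟨hc.le, hαq.le⟩
  have hclosed : IsCompact (Set.Icc (-c) q ∩ topEigenvalue a k ⁻¹' {α}) :=
    isCompact_Icc.of_isClosed_subset
      (hcont.preimage_isClosed_of_isClosed isClosed_Icc isClosed_singleton) Set.inter_subset_left
  obtain ⟨d, ⟨hd, hdα⟩, hmin⟩ := hclosed.exists_isLeast ⟨z, hz, hzα⟩
  refine ⟨d, hd.2.trans_lt hq, hdα, fun l hl => ?_⟩
  have hle := topEigenvalue_mono ha hk (hd.2.trans_lt hq) hl.le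
  rw [show topEigenvalue a k d = α from hdα] at hle
  refine lt_of_le_of_ne hle fun heq => ?_
  -- Minimality is only known within `[-c, q]`; monotonicity rules out crossings to the left of
  -- `-c`.
  have hpl : -c ≤ l := by
    by_contra! h
    have := topEigenvalue_mono ha hk (hpq.trans_lt hq) h.le
    linarith
  exact absurd (hmin ⟨⟨hpl, hl.le.trans hd.2⟩, heq⟩) (not_le.2 hl)

/-! ### Eigenvalues of the fiber and zeros of the determinant -/

theorem det_gammaMatrix {a : ℝ} (ha : 0 < a) (α : ℝ) {k : Plane} {l : ℝ}
    (hl : l ∉ Set.range (freeEigenvalue a k)) :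
    (gammaMatrix a α l k).det =
      ((α - topEigenvalue a k l) * (α - g₀ a k l + ‖g a l (x₀ a) k‖) : ℝ) := by
  have hc := conj_g ha (isScattererDifference_x₀ a) hl
  rw [Matrix.det_fin_two, topEigenvalue]
  simp only [gammaMatrix, Matrix.of_apply, scatterer, Matrix.cons_val_zero, Matrix.cons_val_one,
    sub_self, sub_zero, zero_sub, if_true, zero_ne_one, one_ne_zero, if_false, ← ofReal_g₀ ha hl,
    ← hc]
  have hn := Complex.mul_conj' (g a l (x₀ a) k)
  push_cast
  linear_combination -hn

theorem isUnit_det_gammaMatrix {a : ℝ} (ha : 0 < a) {α : ℝ} {k : Plane} {l : ℝ}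
    (hl : l ∉ Set.range (freeEigenvalue a k)) (h : topEigenvalue a k l < α) :
    IsUnit (gammaMatrix a α l k).det := by
  rw [det_gammaMatrix ha α hl, isUnit_iff_ne_zero, Complex.ofReal_ne_zero]
  have h1 := norm_nonneg (g a l (x₀ a) k)
  have h2 := h
  rw [topEigenvalue] at h2
  exact (mul_pos (sub_pos.2 h) (by linarith)).ne'

/-- A point at which the resolvent formula is available is no eigenvalue. -/
theorem notMem_eigenvalues_of_isRegularPoint {a : ℝ} {α : WithTop ℝ} {k : Plane} {l : ℝ}
    (h : IsRegularPoint a α k l) : l ∉ eigenvalues a α k := by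
  rintro ⟨ψ, hψ, hg⟩
  apply hψ
  ext m
  -- Evaluated at `l` itself, the resolvent acts on `l ψ - l ψ = 0`.
  rw [hg l h m]
  simp [resolventApply]

theorem memℓp_F {a : ℝ} (ha : 0 < a) (l : ℝ) (k : Plane) (j : Fin 2) :
    Memℓp (fun m => F a l k j m) 2 := by
  refine memℓp_gen ((summable_inv_abs_mul_inv_abs ha k l l).congr fun m => ?_)
  rw [F, norm_div, norm_wave, ← Complex.ofReal_sub, Complex.norm_real, Real.norm_eq_abs]
  norm_num
  rw [sq, mul_inv, ← mul_inv, ← mul_inv, abs_mul_abs_self]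

/-- The functions `F_{λ,y_j}` as elements of the Hilbert space. -/
def greenVector {a : ℝ} (ha : 0 < a) (l : ℝ) (k : Plane) (j : Fin 2) : FiberSpace :=
  ⟨fun m => F a l k j m, memℓp_F ha l k j⟩

theorem hasSum_conj_F_mul_F {a : ℝ} (ha : 0 < a) (l l' : ℝ) (k : Plane) (i j : Fin 2) :
    HasSum (fun m => conj (F a l k j m) * F a l' k i m)
      (resolventSum a l l' (scatterer a j - scatterer a i) k) := by
  refine (summable_wave_div ha k _ l l').hasSum.congr_fun fun m => ?_
  rw [F, F, map_div₀, conj_wave, neg_neg, map_sub, Complex.conj_ofReal, Complex.conj_ofReal,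
    div_mul_div_comm, ← wave_add, ← sub_eq_add_neg]

theorem gammaMatrix_sub_gammaMatrix {a : ℝ} (ha : 0 < a) (α : ℝ) {k : Plane} {l l' : ℝ}
    (hl : l ∉ Set.range (freeEigenvalue a k)) (hl' : l' ∉ Set.range (freeEigenvalue a k))
    (i j : Fin 2) :
    gammaMatrix a α l k i j - gammaMatrix a α l' k i j =
      (areaΓ a : ℂ)⁻¹ * (((l' : ℂ) - l) *
        resolventSum a l l' (scatterer a j - scatterer a i) k) := by
  have h := g_sub_g ha (isScattererDifference_sub a j i) hl hl'
  simp only [gammaMatrix, Matrix.of_apply]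
  linear_combination -h

/-- The ratio of the two functions is the phase of `x₀`, and it takes different values on different
residue classes; two classes already force both coefficients to vanish. -/
theorem eq_zero_of_sum_mul_F_eq_zero {a : ℝ} (ha : 0 < a) {k : Plane} {l : ℝ}
    (hl : l ∉ Set.range (freeEigenvalue a k)) {c : Fin 2 → ℂ}
    (h : ∀ m, ∑ j, c j * F a l k j m = 0) : c = 0 := by
  have h1 : ∀ m, c 0 + c 1 * conj (wave a k m (x₀ a)) = 0 := by
    intro m
    have hm := h m
    have hne := ofReal_freeEigenvalue_sub_ne_zero hl m
    rw [Fin.sum_univ_two, F, F] at hm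
    simp only [scatterer, Matrix.cons_val_zero, Matrix.cons_val_one, neg_zero, wave_zero] at hm
    rw [conj_wave]
    field_simp at hm
    linear_combination hm
  have hw : ∀ c' : Fin 3, conj (wave a k (classEquiv (c', (0, 0))) (x₀ a)) =
      conj (wave a k (classEquiv (0, (0, 0))) (x₀ a)) *
        conj (Complex.exp (2 * Real.pi * Complex.I / 3)) ^ (2 * (c' : ℕ)) := by
    intro c'
    rw [wave_x₀_classEquiv ha, wave_x₀_classEquiv ha, ← map_pow, ← map_mul]
    simp
  have e0 := h1 (classEquiv (0, (0, 0)))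
  have e1 := h1 (classEquiv (1, (0, 0)))
  rw [hw 1] at e1
  have hne : conj (Complex.exp (2 * Real.pi * Complex.I / 3)) ^ (2 * ((1 : Fin 3) : ℕ)) ≠ 1 := by
    intro h
    rw [← map_pow] at h
    have h2 := (starRingEnd ℂ).injective (h.trans (map_one _).symm)
    have h3 := Complex.isPrimitiveRoot_exp 3 (by norm_num)
    push_cast at h3
    exact h3.pow_ne_one_of_pos_of_lt (l := 2) (by norm_num) (by norm_num) h2
  have hw0 : conj (wave a k (classEquiv (0, (0, 0))) (x₀ a)) ≠ 0 := by
    rw [← norm_ne_zero_iff, RCLike.norm_conj, norm_wave]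
    exact one_ne_zero
  have hc1 : c 1 = 0 := by
    have : c 1 * (conj (wave a k (classEquiv (0, (0, 0))) (x₀ a)) *
      (conj (Complex.exp (2 * Real.pi * Complex.I / 3)) ^ (2 * ((1 : Fin 3) : ℕ)) - 1)) = 0 := by
      linear_combination e1 - e0
    exact (mul_eq_zero.1 this).resolve_right (mul_ne_zero hw0 (sub_ne_zero.2 hne))
  have hc0 : c 0 = 0 := by rw [hc1, zero_mul, add_zero] at e0; exact e0
  funext j
  fin_cases j
  · exact hc0
  · exact hc1

/-- A regular point of the free operator where `Γ_α` is singular is an eigenvalue. -/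
theorem mem_eigenvalues_of_det_eq_zero {a : ℝ} (ha : 0 < a) (α : ℝ) {k : Plane} {μ : ℝ}
    (hμ : μ ∉ Set.range (freeEigenvalue a k)) (hdet : (gammaMatrix a α μ k).det = 0) :
    μ ∈ eigenvalues a (α : WithTop ℝ) k := by
  obtain ⟨c, hc0, hc⟩ := Matrix.exists_vecMul_eq_zero_iff.2 hdet
  set ψ : FiberSpace := ∑ i, c i • greenVector ha μ k i with hψ
  have hψm : ∀ m, ψ m = ∑ i, c i * F a μ k i m := by
    intro m
    rw [hψ, Fin.sum_univ_two, Fin.sum_univ_two]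
    rfl
  refine ⟨ψ, fun h0 => hc0 (eq_zero_of_sum_mul_F_eq_zero ha hμ fun m => ?_), ?_⟩
  · rw [← hψm, h0]; rfl
  intro l hl m
  obtain ⟨hl1, hl2⟩ := hl
  have hunit := hl2 α rfl
  have hdiff : ∀ n, ((μ : ℂ) • ψ - (l : ℂ) • ψ : FiberSpace) n = ((μ : ℂ) - l) * ψ n := by
    intro n
    rw [← sub_smul]
    rfl
  -- Pairing `(μ - l) ψ` with the Green vectors at `l` yields `c (Γ(l) - Γ(μ))`, by the resolvent
  -- difference for `g`, and `c Γ(μ) = 0`. Multiplying by `Γ(l)⁻¹` then returns `c`, whatever the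
  -- regular point `l` is.
  have hinner : ∀ j, (areaΓ a : ℂ)⁻¹ *
      (∑' n, conj (F a l k j n) * ((μ : ℂ) • ψ - (l : ℂ) • ψ : FiberSpace) n) =
        Matrix.vecMul c (gammaMatrix a α l k) j := by
    intro j
    have h1 : HasSum (fun n => conj (F a l k j n) * ((μ : ℂ) • ψ - (l : ℂ) • ψ : FiberSpace) n)
        (((μ : ℂ) - l) * ∑ i, c i * resolventSum a l μ (scatterer a j - scatterer a i) k) := by
      refine ((hasSum_sum fun i _ => (hasSum_conj_F_mul_F ha l μ k i j).mul_left (c i)).mul_left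
        ((μ : ℂ) - l)).congr_fun fun n => ?_
      rw [hdiff, hψm, Finset.mul_sum, Finset.mul_sum, Finset.mul_sum]
      exact Finset.sum_congr rfl fun i _ => by ring
    have h2 : Matrix.vecMul c (gammaMatrix a α μ k) j = 0 := by rw [hc]; rfl
    rw [h1.tsum_eq, ← sub_zero (Matrix.vecMul c (gammaMatrix a α l k) j), ← h2]
    simp only [Matrix.vecMul, dotProduct]
    rw [← Finset.sum_sub_distrib, Finset.mul_sum, Finset.mul_sum]
    refine Finset.sum_congr rfl fun i _ => ?_
    rw [← mul_sub, gammaMatrix_sub_gammaMatrix ha α hl1 hμ i j]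
    ring
  have hsecond : (areaΓ a : ℂ)⁻¹ * ∑ j : Fin 2, ∑ j' : Fin 2, gammaInv a (α : WithTop ℝ) l k j j' *
      (∑' n, conj (F a l k j n) * ((μ : ℂ) • ψ - (l : ℂ) • ψ : FiberSpace) n) * F a l k j' m =
        ∑ j', c j' * F a l k j' m := by
    have hv : ∀ j', ∑ j, Matrix.vecMul c (gammaMatrix a α l k) j * (gammaMatrix a α l k)⁻¹ j j' =
        c j' := by
      intro j'
      change Matrix.vecMul (Matrix.vecMul c (gammaMatrix a α l k)) (gammaMatrix a α l k)⁻¹ j' = c j'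
      rw [Matrix.vecMul_vecMul, Matrix.mul_nonsing_inv _ hunit, Matrix.vecMul_one]
    rw [Finset.sum_comm, Finset.mul_sum]
    refine Finset.sum_congr rfl fun j' _ => ?_
    rw [← hv j', Finset.mul_sum, Finset.sum_mul]
    refine Finset.sum_congr rfl fun j _ => ?_
    rw [← hinner j]
    change _ * ((gammaMatrix a α l k)⁻¹ j j' * _ * _) = _
    ring
  rw [resolventApply, hsecond]
  change ψ m = ((μ : ℂ) • ψ - (l : ℂ) • ψ : FiberSpace) m / _ + _
  rw [hdiff, hψm, Finset.mul_sum, Finset.sum_div, ← Finset.sum_add_distrib]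
  refine Finset.sum_congr rfl fun i _ => ?_
  have h1 := ofReal_freeEigenvalue_sub_ne_zero hl1 m
  have h2 := ofReal_freeEigenvalue_sub_ne_zero hμ m
  rw [F, F]
  field_simp
  ring

/-- The lowest eigenvalue lies below the free spectrum, at the first point where `α` is the largest
eigenvalue of the matrix of values of `g`. -/
theorem isLeast_eigenvalues {a : ℝ} (ha : 0 < a) {α : ℝ} {k : Plane} (hk : k ∈ brillouinZone a)
    {c : ℝ} (hc : c < ‖k‖ ^ 2) (hα : topEigenvalue a k c = α)
    (hlt : ∀ l < c, topEigenvalue a k l < α) : IsLeast (eigenvalues a (α : WithTop ℝ) k) c := by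
  have hreg := notMem_range_of_lt hk hc
  refine ⟨mem_eigenvalues_of_det_eq_zero ha α hreg ?_, fun μ hμ => ?_⟩
  · rw [det_gammaMatrix ha α hreg, hα, sub_self, zero_mul, Complex.ofReal_zero]
  · by_contra! h
    have hregμ := notMem_range_of_lt hk (h.trans hc)
    refine notMem_eigenvalues_of_isRegularPoint ⟨hregμ, fun b hb => ?_⟩ hμ
    rw [← WithTop.coe_injective hb]
    exact isUnit_det_gammaMatrix ha hregμ (hlt μ h)

theorem isLeast_eigenvalues_top {a : ℝ} {k : Plane} (hk : k ∈ brillouinZone a) :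
    IsLeast (eigenvalues a ⊤ k) (‖k‖ ^ 2) := by
  -- The eigenvector is the plane wave `m = 0`, the lowest mode on the Brillouin zone.
  refine ⟨⟨lp.single 2 0 1, ?_, fun l hl m => ?_⟩, fun μ hμ => ?_⟩
  · intro h
    have := congrArg (fun f : FiberSpace => f 0) h
    simp at this
  · have h1 := ofReal_freeEigenvalue_sub_ne_zero hl.1 m
    have hdiff : (((‖k‖ ^ 2 : ℝ) : ℂ) • lp.single 2 0 1 - (l : ℂ) • lp.single 2 0 1 : FiberSpace) m =
        (((‖k‖ ^ 2 : ℝ) : ℂ) - l) * (lp.single 2 0 1 : FiberSpace) m := by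
      rw [← sub_smul]
      rfl
    rw [resolventApply]
    change (lp.single 2 0 1 : FiberSpace) m = (((‖k‖ ^ 2 : ℝ) : ℂ) • lp.single 2 0 1 -
      (l : ℂ) • lp.single 2 0 1 : FiberSpace) m / _ + _
    rw [hdiff]
    simp only [gammaInv, Matrix.zero_apply, zero_mul, Finset.sum_const_zero, mul_zero, add_zero]
    by_cases hm : m = 0
    · subst hm
      rw [freeEigenvalue_zero] at h1 ⊢
      field_simp
    · rw [lp.single_apply_ne _ _ _ hm]
      simp
  · by_contra! h
    exact notMem_eigenvalues_of_isRegularPoint ⟨notMem_range_of_lt hk h,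
      fun b hb => absurd hb.symm (WithTop.coe_ne_top)⟩ hμ

end Honeycomb

end

/-! ### Comparison of the first crossings -/

theorem mainTheorem10 (a : ℝ) (ha : 0 < a) (α : WithTop ℝ) :
    (∀ k ∈ Honeycomb.brillouinZone a,
      IsLeast (Honeycomb.eigenvalues a α k) (Honeycomb.lowestBand a α k)) ∧
    IsLeast (Honeycomb.lowestBand a α '' Honeycomb.brillouinZone a)
      (Honeycomb.lowestBand a α 0) := by
  open Honeycomb in
  have h0 := zero_mem_brillouinZone a
  suffices h : ∃ lam : Plane → ℝ, (∀ k ∈ brillouinZone a, IsLeast (eigenvalues a α k) (lam k)) ∧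
      ∀ k ∈ brillouinZone a, lam 0 ≤ lam k by
    obtain ⟨lam, hlam, hmin⟩ := h
    have heq : ∀ k ∈ brillouinZone a, lowestBand a α k = lam k :=
      fun k hk => (hlam k hk).csInf_eq
    refine ⟨fun k hk => by rw [heq k hk]; exact hlam k hk, ⟨0, h0, rfl⟩, ?_⟩
    rintro _ ⟨k, hk, rfl⟩
    rw [heq k hk, heq 0 h0]
    exact hmin k hk
  induction α using WithTop.recTopCoe with
  | top =>
    refine ⟨fun k => ‖k‖ ^ 2, fun k hk => isLeast_eigenvalues_top hk, fun k _ => ?_⟩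
    simp
  | coe α =>
    choose! lam hlt heq hbelow using fun k (hk : k ∈ brillouinZone a) =>
      exists_first_crossing ha hk α
    refine ⟨lam, fun k hk => isLeast_eigenvalues ha hk (hlt k hk) (heq k hk) (hbelow k hk),
      fun k hk => ?_⟩
    by_contra! h
    -- The crossing at zero quasi-momentum lies below `‖0‖ ^ 2 = 0`, so the comparison for negative
    -- energies applies at `lam k`.
    have hneg : lam k < 0 := h.trans (by simpa using hlt 0 h0)
    have h1 := topEigenvalue_le_zero_momentum ha k hneg
    have h2 := hbelow 0 h0 _ h
    rw [heq k hk] at h1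
    exact absurd h1 (not_le.2 h2)
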